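/- Let $\omega=e^{2\pi i/3}$ and $\mathbb T=\{z\in\mathbb C:|z|=1\}$. A complex Hadamard matrix of order $N$ is an $N\times N$ matrix $H$ with entries in $\mathbb T$ and $H^\dagger H=NI$. Two such matrices are equivalent, $H\sim K$, if $H=P_1D_1KD_2P_2$ with permutation matrices $P_i$ and diagonal unitary matrices $D_i$; a family $S$ is a suborbit of $T$ if every matrix in $S$ is equivalent to a matrix in $T$. A $p$-parameter orbit of Hadamard matrices is affine if the set of its dephased matrices (rows and columns multiplied by phases so that the first row and column consist of ones) is $\{(e^{i(\Phi_{jk}+L(t)_{jk})})_{jk}:t\in\mathbb R^p\}$ for some real matrix $\Phi$ and some injective real-linear map $L$ from $\mathbb R^p$ to the real $N\times N$ matrices. The defect of $H$ is $r-(2N-1)$, where $r$ is the dimension of the real space of real matrices $R$ such that $\frac{d}{dt}(H(t)^\dagger H(t))|_{t=0}=0$ for $H(t)_{jk}=H_{jk}e^{itR_{jk}}$; the generic defect of an orbit is the smallest defect encountered along it. For $x,y,u,w\in\mathbb C$ let $$H(x,y,u,w)=\begin{pmatrix}A&B&B^T\\B^T&A&B\\B&B^T&A\end{pmatrix},\quad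 A=\begin{pmatrix}1&x&x\\x&1&x\\x&x&1\end{pmatrix},\quad B=\begin{pmatrix}y&u&w\\w&y&u\\u&w&y\end{pmatrix},$$ let $BC_9^{(2)}=\{H(x,y,u,w): x,y,u,w\in\mathbb T,\ x+y+u+w=1\}$ and $BC_{9A}^{(1)}=\{H(\mu,-\mu,-\omega,-\omega^2):\mu\in\mathbb T\}$. Let $F_9^{(4)}$ be the set of the matrices $$\begin{pmatrix}F_3&\Delta_1F_3&\Delta_2F_3\\F_3&\omega\Delta_1F_3&\omega^2\Delta_2F_3\\F_3&\omega^2\Delta_1F_3&\omega\Delta_2F_3\end{pmatrix},\quad F_3=\begin{pmatrix}1&1&1\\1&\omega&\omega^2\\1&\omega^2&\omega\end{pmatrix},\quad \Delta_1=\mathrm{diag}(1,x_1,x_2),\ \Delta_2=\mathrm{diag}(1,x_3,x_4),\ x_i\in\mathbb T.$$ Then: 1. If $\mu\in\mathbb T$ and $(x,y,u,w)$ is a permutation of $(\mu,-\mu,-\omega,-\omega^2)$, then $H(x,y,u,w)\in BC_9^{(2)}$, and $\zeta=2(x+y)-1$ equals $\pm1$, $i\sqrt3\pm2\mu$ or $-i\sqrt3\pm2\mu$.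 2. Let $\zeta=-1-\varepsilon i\mu$ with $\mu\in\mathbb T$ and $\varepsilon\to0^+$. Then $\frac14(1+\zeta)\bigl(1\pm i\sqrt{16/|1+\zeta|^2-1}\bigr)\to\pm\mu$, and $\frac14(1-\zeta)\bigl(1\pm i\sqrt{16/|1-\zeta|^2-1}\bigr)$ tends to $-\omega^2$ for the sign $+$ and to $-\omega$ for the sign $-$. 3. For $\mu\in\mathbb T$ the matrix $H(\mu,-\mu,-\omega,-\omega^2)$ has the above block form with $$A=\begin{pmatrix}1&\mu&\mu\\\mu&1&\mu\\\mu&\mu&1\end{pmatrix},\qquad B=-\begin{pmatrix}\mu&\omega&\omega^2\\\omega^2&\mu&\omega\\\omega&\omega^2&\mu\end{pmatrix}.$$ 4. $BC_{9A}^{(1)}\subseteq BC_9^{(2)}$, and $BC_{9A}^{(1)}$ is an affine one-parameter orbit of complex Hadamard matrices. 5. The generic defect of $BC_{9A}^{(1)}$ is $2$, and the defect of $H(\mu,-\mu,-\omega,-\omega^2)$ is $2$ for all but finitely many $\mu\in\mathbb T$. 6. $BC_{9A}^{(1)}$ is not a suborbit of $F_9^{(4)}$. -/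

import Mathlib

open scoped Matrix

namespace BC9

noncomputable section

/-- The primitive cube root of unity `ω = exp(2πi/3)`. -/
def om : ℂ := Complex.exp (2 * (Real.pi : ℂ) * Complex.I / 3)

/-- Complex Hadamard matrices: unimodular entries and `Hᴴ H = n I`. -/
def IsHadamard {n : ℕ} (H : Matrix (Fin n) (Fin n) ℂ) : Prop :=
  (∀ i j, ‖H i j‖ = 1) ∧ Hᴴ * H = (n : ℂ) • (1 : Matrix (Fin n) (Fin n) ℂ)

/-- Equivalence `H = P₁ D₁ K D₂ P₂`, with `D₁, D₂` diagonal unitary and `P₁, P₂` permutation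
matrices. -/
def Equivalent {n : ℕ} (H K : Matrix (Fin n) (Fin n) ℂ) : Prop :=
  ∃ (p q : Equiv.Perm (Fin n)) (d e : Fin n → ℂ),
    (∀ i, ‖d i‖ = 1) ∧ (∀ i, ‖e i‖ = 1) ∧
    H = p.permMatrix ℂ * Matrix.diagonal d * K * Matrix.diagonal e * q.permMatrix ℂ

/-- The family `S` is, up to equivalence of matrices, contained in the orbit `T`. -/
def IsSuborbit {n : ℕ} (S T : Set (Matrix (Fin n) (Fin n) ℂ)) : Prop :=
  ∀ H ∈ S, ∃ K ∈ T, Equivalent H K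

/-- The dephased form of a matrix with unimodular entries: the rows and columns are multiplied by
unimodular factors so that the first row and the first column consist of ones. -/
def dephase {n : ℕ} [NeZero n] (H : Matrix (Fin n) (Fin n) ℂ) : Matrix (Fin n) (Fin n) ℂ :=
  Matrix.of fun i j => (H i 0)⁻¹ * H 0 0 * H i j * (H 0 j)⁻¹

/-- `S` is a `p`-parameter affine orbit of Hadamard matrices: the dephased matrices are exactly the
matrices with entries `exp(i (Φ_{jk} + L(t)_{jk}))`, with phases depending linearly
(and, so that there are `p` parameters, injectively) on the parameter `t ∈ ℝ^p`. -/
def IsAffineOrbit {n : ℕ} [NeZero n] (p : ℕ) (S : Set (Matrix (Fin n) (Fin n) ℂ)) : Prop :=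
  (∀ H ∈ S, IsHadamard H) ∧
  ∃ (Φ : Matrix (Fin n) (Fin n) ℝ) (L : (Fin p → ℝ) →ₗ[ℝ] Matrix (Fin n) (Fin n) ℝ),
    Function.Injective L ∧
    dephase '' S = Set.range fun t : Fin p → ℝ =>
      Matrix.of fun j k => Complex.exp (Complex.I * ((Φ j k + L t j k : ℝ) : ℂ))

/-- The deformation of `H` with entries `H_{jk} exp(i t R_{jk})`. -/
def phaseDeform {n : ℕ} (H : Matrix (Fin n) (Fin n) ℂ) (R : Matrix (Fin n) (Fin n) ℝ) (t : ℝ) :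
    Matrix (Fin n) (Fin n) ℂ :=
  Matrix.of fun j k => H j k * Complex.exp (Complex.I * (t : ℂ) * (R j k : ℂ))

/-- The derivative at `t = 0` of `H(t)ᴴ H(t)`, where `H(t) = phaseDeform H R t`, as a linear map
in `R`; see `hasDerivAt_phaseDeform`. -/
def unitarityDeriv {n : ℕ} (H : Matrix (Fin n) (Fin n) ℂ) :
    Matrix (Fin n) (Fin n) ℝ →ₗ[ℝ] Matrix (Fin n) (Fin n) ℂ where
  toFun R := Matrix.of fun i j =>
    ∑ k, star (H k i) * H k j * (Complex.I * ((R k j - R k i : ℝ) : ℂ))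
  map_add' R S := by
    ext i j
    simp only [Matrix.of_apply, Matrix.add_apply, ← Finset.sum_add_distrib]
    refine Finset.sum_congr rfl fun k _ => ?_
    push_cast
    ring
  map_smul' c R := by
    ext i j
    simp only [Matrix.of_apply, Matrix.smul_apply, RingHom.id_apply, Finset.smul_sum,
      Complex.real_smul, smul_eq_mul]
    refine Finset.sum_congr rfl fun k _ => ?_
    push_cast
    ring

theorem hasDerivAt_phaseDeform {n : ℕ} (H : Matrix (Fin n) (Fin n) ℂ)
    (R : Matrix (Fin n) (Fin n) ℝ) (i j : Fin n) :
    HasDerivAt (fun t : ℝ => ((phaseDeform H R t)ᴴ * phaseDeform H R t) i j)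
      (unitarityDeriv H R i j) 0 := by
  have key : ∀ t : ℝ, ((phaseDeform H R t)ᴴ * phaseDeform H R t) i j =
      ∑ k, star (H k i) * H k j *
        Complex.exp ((t : ℂ) * (Complex.I * ((R k j - R k i : ℝ) : ℂ))) := by
    intro t
    simp only [Matrix.mul_apply, Matrix.conjTranspose_apply, phaseDeform, Matrix.of_apply]
    refine Finset.sum_congr rfl fun k _ => ?_
    rw [star_mul']
    have hs : star (Complex.exp (Complex.I * (t : ℂ) * (R k i : ℂ))) =
        Complex.exp (-Complex.I * (t : ℂ) * (R k i : ℂ)) := by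
      rw [Complex.star_def, ← Complex.exp_conj]
      simp only [map_mul, Complex.conj_I, Complex.conj_ofReal]
    rw [hs]
    have : (t : ℂ) * (Complex.I * ((R k j - R k i : ℝ) : ℂ)) =
        -Complex.I * (t : ℂ) * (R k i : ℂ) + Complex.I * (t : ℂ) * (R k j : ℂ) := by
      push_cast
      ring
    rw [this, Complex.exp_add]
    ring
  simp only [key]
  refine HasDerivAt.fun_sum fun k _ => ?_
  have h1 : HasDerivAt (fun t : ℝ => (t : ℂ) * (Complex.I * ((R k j - R k i : ℝ) : ℂ)))
      (1 * (Complex.I * ((R k j - R k i : ℝ) : ℂ))) 0 :=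
    (Complex.ofRealCLM.hasDerivAt (x := (0 : ℝ))).mul_const _
  have h2 := (h1.cexp).const_mul (star (H k i) * H k j)
  simpa using h2

/-- The defect `d(H) = r - (2n - 1)`, where `r` is the dimension of the real vector space of the
real matrices `R` for which `H(t)ᴴ H(t)` has zero derivative at `t = 0`. -/
def defect {n : ℕ} (H : Matrix (Fin n) (Fin n) ℂ) : ℤ :=
  (Module.finrank ℝ (LinearMap.ker (unitarityDeriv H)) : ℤ) - (2 * (n : ℤ) - 1)

/-- The generic defect of an orbit is the smallest defect encountered along it. -/
def IsGenericDefect {n : ℕ} (S : Set (Matrix (Fin n) (Fin n) ℂ)) (d : ℤ) : Prop :=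
  IsLeast (defect '' S) d

/-- The `9 × 9` matrix with the given `3 × 3` blocks. -/
def ofBlocks (M : Fin 3 → Fin 3 → Matrix (Fin 3) (Fin 3) ℂ) : Matrix (Fin 9) (Fin 9) ℂ :=
  Matrix.of fun i j =>
    M (Fin.divNat (m := 3) (n := 3) i) (Fin.divNat (m := 3) (n := 3) j)
      (Fin.modNat (m := 3) (n := 3) i) (Fin.modNat (m := 3) (n := 3) j)

/-- The basic symmetric block circulant matrix with circulant blocks. -/
def basicForm (x y u w : ℂ) : Matrix (Fin 9) (Fin 9) ℂ :=
  !![1, x, x, y, u, w, y, w, u;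
     x, 1, x, w, y, u, u, y, w;
     x, x, 1, u, w, y, w, u, y;
     y, w, u, 1, x, x, y, u, w;
     u, y, w, x, 1, x, w, y, u;
     w, u, y, x, x, 1, u, w, y;
     y, u, w, y, w, u, 1, x, x;
     w, y, u, u, y, w, x, 1, x;
     u, w, y, w, u, y, x, x, 1]

/-- The two-parameter orbit `BC₉⁽²⁾`. -/
def BC9Two : Set (Matrix (Fin 9) (Fin 9) ℂ) :=
  {H | ∃ x y u w : ℂ, ‖x‖ = 1 ∧ ‖y‖ = 1 ∧ ‖u‖ = 1 ∧ ‖w‖ = 1 ∧ x + y + u + w = 1 ∧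
    H = basicForm x y u w}

/-- The matrix with `(x, y, u, w) = (μ, -μ, -ω, -ω²)`. -/
def matA (μ : ℂ) : Matrix (Fin 9) (Fin 9) ℂ := basicForm μ (-μ) (-om) (-om ^ 2)

/-- The family `BC₉ₐ⁽¹⁾`. -/
def BC9A : Set (Matrix (Fin 9) (Fin 9) ℂ) := {H | ∃ μ : ℂ, ‖μ‖ = 1 ∧ H = matA μ}

/-- `c/4 (1 + s i √(16/|c|² - 1))` for a sign `s`. For `c = 1 + ζ` these are the entries `x, y`,
for `c = 1 - ζ` the entries `u, w`, of the member of `BC₉⁽²⁾` with parameter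
`ζ = 2(x + y) - 1 ≠ ±1`. -/
def zetaEntry (s : ℝ) (c : ℂ) : ℂ :=
  (1 / 4 : ℂ) * c * (1 + (s : ℂ) * Complex.I * (Real.sqrt (16 / ‖c‖ ^ 2 - 1) : ℂ))

/-- The Fourier matrix of order three. -/
def F3 : Matrix (Fin 3) (Fin 3) ℂ :=
  !![1, 1, 1;
     1, om, om ^ 2;
     1, om ^ 2, om]

/-- The matrix with block rows `(F₃, ω^a Δ₁ F₃, ω^{2a} Δ₂ F₃)`, `a = 0, 1, 2`, where
`Δ₁ = diag(1, x₁, x₂)` and `Δ₂ = diag(1, x₃, x₄)`. -/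
def fourierForm (x₁ x₂ x₃ x₄ : ℂ) : Matrix (Fin 9) (Fin 9) ℂ :=
  ofBlocks
    !![F3, Matrix.diagonal ![1, x₁, x₂] * F3, Matrix.diagonal ![1, x₃, x₄] * F3;
       F3, om • (Matrix.diagonal ![1, x₁, x₂] * F3), om ^ 2 • (Matrix.diagonal ![1, x₃, x₄] * F3);
       F3, om ^ 2 • (Matrix.diagonal ![1, x₁, x₂] * F3), om • (Matrix.diagonal ![1, x₃, x₄] * F3)]

/-- The four-parameter Fourier orbit `F₉⁽⁴⁾`. -/
def F9Four : Set (Matrix (Fin 9) (Fin 9) ℂ) :=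
  {H | ∃ x₁ x₂ x₃ x₄ : ℂ, ‖x₁‖ = 1 ∧ ‖x₂‖ = 1 ∧ ‖x₃‖ = 1 ∧ ‖x₄‖ = 1 ∧
    H = fourierForm x₁ x₂ x₃ x₄}

end

end BC9

namespace BC9

open Matrix Filter Topology

/-! Index rows and columns by `G = (ℤ/3)²`. Every matrix of the family is then a group matrix `H i j
= f (j - i)`, with `f` equal to 1 at the origin and constant on each of the four punctured lines
through it, where it takes the values `x, y, u, w`. The condition `x + y + u + w = 1` makes the
autocorrelation of `f` equal to `9δ`, which is the Hadamard property.

Defect. Translation invariance decouples the linear system for `R` by Fourier transform along the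
diagonals `(k, k + s)`, giving one system on functions of `s` for each of the nine characters `χ`
(`isModeSolution_of_mem_ker`). For `χ ≠ 1` and `μ ^ 12 ≠ 1` all solutions lie in the span of `1` and
`χ`, the contribution of row and column phases (`modeSolution_nontrivial`). For `χ = 1` a solution
is determined by three values (`modeSolution_trivial`). Hence the kernel has dimension at most `8 ·
2 + 3 = 19`; over the reals this count is realised by the functionals of `separating`. Conversely,
for every `μ` the 17 dimensions of row and column phases and two independent solutions of the
linearised equation `x + y + u + w = 1` give dimension at least 19 (`le_finrank_ker`). Since `19 -
17 = 2`, the defect is always at least 2, with equality except possibly at twelfth roots of unity.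

Affine orbit. Writing `μ = exp(it)`, all entries are exponentials of affine functions of `t`, and
dephasing takes mixed differences of the exponents.

Fourier orbit. In a member of `F9Four` two rows have equal entrywise cubes, so any equivalent matrix
has two rows whose cubes are proportional. At `μ = i` the cubes are powers of `i`, and a finite
check of exponents shows that no two rows of cubes are proportional. -/

/-! ### Elimination certificates for the Fourier modes -/

/-- The variables `r0, …, r8` are the values of `r` at `(0,0), (0,1), …, (2,2)`, and `χ (k, l) = w ^
k`; here the kernel line of `χ` carries the entry `m`. The conclusion says that `r` is constant on
the cosets of the kernel and has no `χ⁻¹` component, so that it lies in the span of `1` and `χ`. -/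
theorem span_of_kernel_line_param {m w r0 r1 r2 r3 r4 r5 r6 r7 r8 : ℂ}
    (hw : w^2 + w + 1 = 0)
    (m0 : m ≠ 0) (k1 : m - 1 ≠ 0) (k2 : m + 1 ≠ 0) (k3 : m - w ≠ 0) (k4 : m + w ≠ 0) (k5 : m - w^2
      ≠ 0) (k6 : m + w^2 ≠ 0)
    (e1 : m^2*(r1 - r0) + m*(r2 - r1) + (r0 - r2) + w^3*(r4 - r3) + m*w^6*(r5 - r4) + m^2*w^3*(r3
      - r5) + w^3*(r7 - r6) + m*w^3*(r8 - r7) + m^2*w^3*(r6 - r8) = 0)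
    (e2 : m^2*(r2 - r0) + (r0 - r1) + m*(r1 - r2) + w^4*(r5 - r3) + m^2*w^4*(r3 - r4) + m*w^4*(r4
      - r5) + w^2*(r8 - r6) + m^2*w^2*(r6 - r7) + m*w^5*(r7 - r8) = 0)
    (e3 : -m^2*(r3 - r0) - w*(r4 - r1) - w^2*(r5 - r2) + m*w^2*(r6 - r3) + m*w^6*(r7 - r4) +
      m*w^4*(r8 - r5) - w*(r0 - r6) - m^2*w^2*(r1 - r7) - m^2*w^3*(r2 - r8) = 0)
    (e4 : -m*w*(r4 - r0) - w^2*(r5 - r1) - m*(r3 - r2) + w^4*(r7 - r3) + m*w^5*(r8 - r4) +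
      m^2*w^3*(r6 - r5) - m*w*(r1 - r6) - m^2*w^2*(r2 - r7) - m*w^3*(r0 - r8) = 0)
    (e5 : -m*w^2*(r5 - r0) - m*(r3 - r1) - w*(r4 - r2) + w^3*(r8 - r3) + m^2*w^4*(r6 - r4) +
      m*w^5*(r7 - r5) - m*w*(r2 - r6) - m*w^2*(r0 - r7) - m^2*w^3*(r1 - r8) = 0)
    (e6 : -m^2*(r6 - r0) - w^2*(r7 - r1) - w*(r8 - r2) - w^2*(r0 - r3) - m^2*w^4*(r1 - r4) -
      m^2*w^3*(r2 - r5) + m*w*(r3 - r6) + m*w^3*(r4 - r7) + m*w^5*(r5 - r8) = 0)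
    (e7 : -m*w^2*(r7 - r0) - w*(r8 - r1) - m*(r6 - r2) - m*w^2*(r1 - r3) - m^2*w^4*(r2 - r4) -
      m*w^3*(r0 - r5) + w^2*(r4 - r6) + m*w^4*(r5 - r7) + m^2*w^3*(r3 - r8) = 0)
    (e8 : -m*w*(r8 - r0) - m*(r6 - r1) - w^2*(r7 - r2) - m*w^2*(r2 - r3) - m*w^4*(r0 - r4) -
      m^2*w^3*(r1 - r5) + w^3*(r5 - r6) + m^2*w^2*(r3 - r7) + m*w^4*(r4 - r8) = 0) :
    r1 = r0 ∧ r2 = r0 ∧ r4 = r3 ∧ r5 = r3 ∧ r7 = r6 ∧ r8 = r6 ∧ r0 + w*r3 + w^2*r6 = 0 := by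
  -- Gaussian elimination over the polynomials in `m` and `w`: each relation, multiplied by a
  -- nonzero pivot, is a combination of the equations and of relations already found, modulo `hw`.
  have ha1 : r1 - r2 = 0 := by
    refine (mul_eq_zero_iff_left (a := (m - 1)*(m - 1)*(m + 1)*(m + w)*(m + w^2))
      (mul_ne_zero (mul_ne_zero (mul_ne_zero (mul_ne_zero k1 k1) k2) k4) k6)).1 ?_
    linear_combination (4/3*m + 2/3*m*w - 4/3*m^2 - 2/3*m^2*w)*e4 +
      (-1/3 + 1/3*w - 1/3*m - 2/3*m*w + 1/3*m^2 - 1/3*m^2*w + 1/3*m^3 + 2/3*m^3*w)*e5 +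
      (2/3 + 2/3*w - 2/3*m - 2/3*m*w - 2/3*m^2 - 2/3*m^2*w + 2/3*m^3 + 2/3*m^3*w)*e6 +
      (-2/3*w + 2/3*m*w + 2/3*m^2 - 2/3*m^3)*e7 + (1/3*w - 1/3*m - 1/3*m^2*w + 1/3*m^3)*e8 +
      (1/3 - 2/3*w + 1/3*m + 1/3*m^2 + m^3 + 2/3*m^3*w)*e1 +
      (-1/3 + 1/3*m + 1/3*m^2 - 1/3*m^3)*e2 +
      ((-1/3 + 1/3*w + 4/3*m - 5/3*m*w + 5/3*m^2 - 2/3*m^2*w + 2/3*m^2*w^2 + 2/3*m^2*w^3 -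
      2*m^3 + m^3*w - 2/3*m^3*w^2 - 2/3*m^3*w^3 - 2/3*m^4 + 5/3*m^4*w - 2/3*m^4*w^2 - 2/3*m^4*w^3
      - 2/3*m^5*w + 2/3*m^5*w^2 + 2/3*m^5*w^3)*r1 + (1/3 - 4/3*w - 1/3*m + 4/3*m*w - 5/3*m^2 +
      4/3*m^2*w + 4/3*m^2*w^2 - 2/3*m^2*w^3 + 7/3*m^3 - 2/3*m^3*w - 4/3*m^3*w^2 + 2/3*m^3*w^3 -
      4/3*m^4*w - 2/3*m^5 + 2/3*m^5*w)*r2 + (2/3*w - 2/3*m + 2/3*m*w - m*w^2 + 1/3*m*w^3 - 4/3*m^2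
      - m^2*w + m^2*w^2 + 2/3*m^3 + 2/3*m^3*w - 1/3*m^3*w^2 - 1/3*m^3*w^3 + 4/3*m^4 - m^4*w +
      1/3*m^4*w^2)*r0 + (-1/3*w + 2/3*w^2 - 1/3*m*w - 1/3*m*w^2 - m*w^3 + m*w^4 - 2/3*m*w^5 +
      5/3*m^2*w - 2*m^2*w^2 + 2/3*m^2*w^3 + m^2*w^4 - m^3*w + 5/3*m^3*w^2 - m^3*w^3 - 1/3*m^3*w^4
      - 2/3*m^4*w^3 + 1/3*m^4*w^4 + 2/3*m^4*w^5)*r4 + (2/3*w - 1/3*w^2 - 2/3*m*w + 2/3*m*w^2 +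
      2/3*m*w^4 - 1/3*m^2*w - 2/3*m^2*w^2 - 1/3*m^2*w^3 - 4/3*m^2*w^4 + 2/3*m^3*w^2 + 2/3*m^3*w^3
      + 1/3*m^4*w - 1/3*m^4*w^2 - 1/3*m^4*w^3 + 2/3*m^4*w^4)*r8 + (-2/3*w^2 - 1/3*m + 1/3*m*w^2 +
      2/3*m*w^3 + m^2 - 1/3*m^2*w + m^2*w^2 - 2/3*m^2*w^3 - m^3 + 2/3*m^3*w + 1/3*m^4 - 1/3*m^4*w
      - 1/3*m^4*w^2 - 1/3*m^5*w^2)*r3 + (-1/3*w^2 + 2/3*m*w + 1/3*m^2 - 2/3*m^2*w + m^2*w^2 -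
      1/3*m^2*w^3 - 2/3*m^3*w - 1/3*m^3*w^2 + 2/3*m^3*w^3 - m^4 + 2/3*m^4*w + 1/3*m^4*w^3 +
      2/3*m^5 - 1/3*m^5*w^2 - 2/3*m^5*w^3)*r6 + (2/3*w^2 - 2/3*m*w^2 - 1/3*m*w^3 - 1/3*m*w^4 -
      2/3*m^2*w^2 + 2/3*m^2*w^3 + 2/3*m^2*w^4 - m^3*w^3 + 1/3*m^3*w^4 + 2/3*m^4*w^2 + 2/3*m^4*w^3
      - 2/3*m^4*w^4)*r7 + (m*w^2 + 1/3*m*w^3 - 4/3*m*w^4 + 2/3*m*w^5 - 5/3*m^2*w^2 - 1/3*m^2*w^4 +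
      1/3*m^3*w^2 + m^3*w^3 + 1/3*m^4*w^2 + 2/3*m^4*w^3 - 1/3*m^4*w^4 - 2/3*m^4*w^5)*r5)*hw
  have hc2 : r6 - r8 = 0 := by
    refine (mul_eq_zero_iff_left (a := m*(m - 1)*(m + 1)*(m - w^2))
      (mul_ne_zero (mul_ne_zero (mul_ne_zero m0 k1) k2) k5)).1 ?_
    linear_combination (-1/3 - 1/6*w - 1/6*m + 1/6*m*w + 1/6*m^2 + 1/3*m^2*w + 1/3*m^3 +
      1/6*m^3*w + 1/6*m^4 - 1/6*m^4*w - 1/6*m^5 - 1/3*m^5*w)*ha1 +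
      (-1/18 + 1/18*w + 1/18*m + 5/18*m*w + 1/18*m^2 - 2/9*m^2*w - 1/18*m^3 - 1/9*m^3*w)*e8 +
      (2/9 + 1/6*w + 1/2*m + 2/9*m*w + 4/9*m^2 + 1/6*m^2*w + 1/6*m^3 + 1/9*m^3*w)*e1 +
      (1/18*w - 5/18*m + 5/18*m^2*w - 1/18*m^3)*e2 +
      (-2/9*w - 1/9*m - 1/9*m*w + 2/9*m^2*w + 1/9*m^3 + 1/9*m^3*w)*e3 +
      (1/9*w + 2/9*m + 2/9*m*w - 1/9*m^2*w - 2/9*m^3 - 2/9*m^3*w)*e4 +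
      (-1/18 + 1/9*m - 1/9*m^2 + 1/18*m^3)*e5 +
      ((-2/9 - 2/9*m - 1/18*m*w + 1/18*m*w^3 - 2/9*m^2 - 1/18*m^2*w + 5/18*m^2*w^3 + 2/9*m^3
      + 1/18*m^3*w + 1/6*m^3*w^2 - 2/9*m^3*w^3 + 4/9*m^4 + 1/18*m^4*w - 1/6*m^4*w^2 -
      1/9*m^4*w^3)*r0 + (1/3 - 1/9*w + 2/9*m - 2/9*m*w + 2/9*m^2 - 5/18*m^2*w + 1/18*m^2*w^2 -
      7/18*m^3 + 5/18*m^3*w^2 - 7/18*m^4 + 7/18*m^4*w - 2/9*m^4*w^2 + 2/9*m^5*w - 1/9*m^5*w^2)*r1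
      + (-1/9 + 1/6*w + 1/9*m - 1/9*m*w - 7/18*m^2 + 11/18*m^2*w - 2/9*m^2*w^2 + 1/3*m^3 -
      1/9*m^3*w^2 + 1/6*m^4 - 4/9*m^4*w + 2/9*m^4*w^2 - 1/9*m^5 - 2/9*m^5*w + 1/9*m^5*w^2)*r2 +
      (-1/18*w - 1/6*w^2 - 1/2*m*w^3 + 7/18*m*w^4 - 1/18*m*w^5 + 1/9*m^2*w + 1/3*m^2*w^2 -
      8/9*m^2*w^3 + 1/2*m^2*w^4 + 1/9*m^2*w^5 + 1/6*m^3*w - 1/6*m^3*w^2 - 1/6*m^3*w^3 -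
      1/18*m^3*w^4 + 7/18*m^3*w^5 - 2/9*m^4*w + 2/9*m^4*w^3 - 1/6*m^4*w^4 + 2/9*m^4*w^5)*r4 +
      (2/9*w^2 - 1/18*m + 5/18*m*w + 1/2*m*w^2 - 17/18*m^2 + 8/9*m^2*w - 5/18*m^2*w^2 + 1/18*m^3 -
      5/18*m^3*w - 5/9*m^3*w^2 + 17/18*m^4 - 8/9*m^4*w + 1/18*m^4*w^2 + 1/18*m^5*w^2)*r6 +
      (-1/18*w^2 - 1/9*w^3 + 1/9*m*w^2 - 1/9*m*w^3 - 5/18*m*w^4 + 2/9*m*w^5 - 1/9*m^2*w^2 +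
      1/6*m^2*w^3 + 1/9*m^2*w^5 - 5/18*m^3*w^2 + 11/18*m^3*w^3 - 1/18*m^3*w^4 - 2/9*m^3*w^5 +
      1/9*m^4*w^3 - 1/9*m^4*w^5)*r7 + (1/6*w^3 - 1/18*m + 1/6*m*w - 1/18*m*w^2 + 2/9*m*w^3 +
      1/3*m^2 - 1/3*m^2*w - 1/9*m^2*w^2 + 1/9*m^2*w^3 - 2/9*m^3 + 1/9*m^3*w^2 - 2/9*m^3*w^3 -
      1/6*m^4 + 1/6*m^4*w + 1/9*m^4*w^2 - 5/18*m^4*w^3 + 1/9*m^5 - 1/18*m^5*w^2)*r3 + (-1/18*w^3 +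
      1/18*m*w^2 - 1/18*m*w^4 - 1/6*m*w^5 + 1/9*m^2*w^2 + 2/9*m^2*w^3 - 5/18*m^2*w^4 - 2/9*m^2*w^5
      - 2/9*m^3*w^2 + 5/6*m^3*w^3 - 5/18*m^3*w^4 - 1/6*m^3*w^5 + 1/18*m^4*w^2 + 1/3*m^4*w^3 -
      1/18*m^4*w^4 - 1/9*m^4*w^5)*r5 + (-1/18*m*w - 11/18*m*w^2 + 1/3*m*w^3 - 1/18*m*w^4 + m^2 -
      17/18*m^2*w + 2/9*m^2*w^2 + 1/9*m^2*w^3 - 2/9*m^2*w^4 + 1/18*m^3*w + 7/9*m^3*w^2 -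
      5/6*m^3*w^3 + 7/18*m^3*w^4 - m^4 + 17/18*m^4*w - 1/18*m^4*w^2 - 5/18*m^4*w^3 +
      2/9*m^4*w^4)*r8)*hw
  have hb1 : r3 - r4 = 0 := by
    refine (mul_eq_zero_iff_left (a := m*(m - 1))
      (mul_ne_zero m0 k1)).1 ?_
    linear_combination (1/3 + 2/3*w - 1/3*m - 2/3*m*w + 2/3*m^2 + 1/3*m^2*w - 2/3*m^3 -
      1/3*m^3*w)*ha1 +
      (-m*w + m^2*w)*hc2 + (-1/3*w + 1/3*m)*e1 + (-1/3 + 1/3*m)*e3 + (1/3 - 1/3*m)*e4 +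
      ((-1/3 + 1/3*m - 1/3*m^2 + 1/3*m^3)*r1 + (1/3 - 1/3*m + 2/3*m^2 - 1/3*m^2*w - 2/3*m^3
      + 1/3*m^3*w)*r2 + (-1/3*w + 1/3*w^2 + m - 1/3*m*w - 2/3*m*w^2 + 2/3*m*w^3 - 1/3*m*w^5 - m^2
      + 2/3*m^2*w + 1/3*m^2*w^2 - m^2*w^3 + 2/3*m^2*w^4)*r4 + (1/3*w - 1/3*w^2 + 1/3*m*w -
      2/3*m^2*w + 1/3*m^2*w^2)*r6 + (-1/3*m + 1/3*m*w + 1/3*m^2 - 1/3*m^2*w)*r0 + (-2/3*m +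
      2/3*m*w - 1/3*m*w^2 + 1/3*m^2 - 1/3*m^2*w + 1/3*m^2*w^2 + 1/3*m^3 - 1/3*m^3*w)*r3 + (-m*w +
      m*w^2 - 1/3*m*w^3 + m^2*w - m^2*w^2 + 1/3*m^2*w^3)*r8 + (-1/3*m*w^3 + 1/3*m*w^4 +
      1/3*m^2*w^3 - 1/3*m^2*w^4)*r7 + (-1/3*m*w^4 + 1/3*m*w^5 + 1/3*m^2*w^3 - 1/3*m^2*w^4)*r5)*hw
  have ha2 : (-1)*r0 + r1 = 0 := by
    refine (mul_eq_zero_iff_left (a := m*(m - 1)*(m - w)*(m - w^2)*(m + w^2))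
      (mul_ne_zero (mul_ne_zero (mul_ne_zero (mul_ne_zero m0 k1) k3) k5) k6)).1 ?_
    linear_combination (m + m*w - m^2 - m^2*w + m^3*w - m^4*w)*ha1 +
      (2/3 + 1/3*w + m + m*w - 2*m^2 - 2*m^2*w + 2*m^3 - m^4 - m^5 + 1/3*m^6 + 2/3*m^6*w)*hc2 +
      (1/3 - 1/3*w - m - m*w - m^2 - m^2*w + 2*m^3 + 2*m^3*w - 2*m^4 + m^5 + 2/3*m^6 +
      1/3*m^6*w)*hb1 +
      (1/3 + 1/3*w - 2/3*m - 1/3*m*w + 2/3*m^2 - 1/3*m^3 + 1/3*m^3*w - 1/3*m^4*w)*e7 +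
      (1/3*w + 1/3*m^2 - 1/3*m^4 - 1/3*m^4*w)*e8 +
      (1/3 - 1/3*m - 2/3*m*w - 2/3*m^2*w + 1/3*m^3 - 1/3*m^3*w - 1/3*m^4 - 1/3*m^4*w)*e1 +
      (-1/3 - 1/3*m + 1/3*m*w - 1/3*m^2*w + 1/3*m^3 + 2/3*m^3*w + 1/3*m^4 + 1/3*m^4*w)*e2 +
      ((-1/3 - 2/3*m + 1/3*m*w + m*w^2 - m*w^3 + 2/3*m^2 - 5/3*m^2*w + 1/3*m^2*w^2 + m^2*w^3
      + 1/3*m^3 + m^3*w - m^3*w^2 - 2/3*m^4 + 2/3*m^4*w + 1/3*m^5 - 1/3*m^5*w + 1/3*m^6 -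
      1/3*m^6*w^2)*r1 + (1/3 - 1/3*w - 1/3*m + 1/3*m*w - 1/3*m^2*w + 1/3*m^2*w^3 + 2/3*m^3*w -
      1/3*m^3*w^2 - 1/3*m^3*w^3 - 1/3*m^4*w + 2/3*m^4*w^2 + 1/3*m^5 - 2/3*m^5*w^2 + 1/3*m^5*w^3 -
      1/3*m^6 + 1/3*m^6*w^2 - 1/3*m^6*w^3)*r2 + (-1/3 + 2/3*w - 1/3*w^2 + m - 4/3*m*w^2 +
      1/3*m*w^3 + m^2 - 1/3*m^2*w^2 - 1/3*m^2*w^3 - 2*m^3 + m^3*w^2 + 1/3*m^3*w^3 + 2*m^4 -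
      2*m^4*w + 2/3*m^4*w^3 - m^5 + m^5*w + 1/3*m^5*w^2 - 2/3*m^5*w^3 - 2/3*m^6 + 1/3*m^6*w +
      2/3*m^6*w^2 - 1/3*m^6*w^3)*r3 + (1/3 - 2/3*w - m + 5/3*m*w^2 - m*w^3 + 1/3*m*w^4 - m^2 +
      1/3*m^2*w^2 - 1/3*m^2*w^3 + 1/3*m^2*w^4 - 2/3*m^2*w^5 + 2*m^3 - 5/3*m^3*w^2 + m^3*w^3 +
      2/3*m^3*w^4 - 2/3*m^3*w^5 - 2*m^4 + 2*m^4*w - 4/3*m^4*w^3 + 2/3*m^4*w^4 - 1/3*m^4*w^5 + m^5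
      - m^5*w + m^5*w^3 - 1/3*m^5*w^5 + 2/3*m^6 - 1/3*m^6*w - 1/3*m^6*w^2 + 2/3*m^6*w^3)*r4 +
      (-2/3 + 1/3*w + 1/3*w^2 - 2/3*m + 1/3*m*w - 2/3*m*w^2 + 4/3*m^2 + 1/3*m^2*w - 2/3*m^2*w^2 -
      m^3 + m^3*w + 1/3*m^3*w^2 + 2/3*m^4 - 1/3*m^4*w + 2/3*m^5 - 4/3*m^5*w + 1/3*m^5*w^2 -
      1/3*m^6 - 1/3*m^6*w + 1/3*m^6*w^2)*r6 + (2/3 + m - 2/3*m*w - 2*m^2 + 2/3*m^2*w + 4/3*m^2*w^2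
      - 2/3*m^2*w^3 + 1/3*m^2*w^4 + 2*m^3 - 2*m^3*w + 1/3*m^3*w^3 - 1/3*m^3*w^4 - m^4 + m^4*w -
      2/3*m^4*w^2 - 1/3*m^4*w^3 + 2/3*m^4*w^4 - m^5 + 2/3*m^5*w - 1/3*m^5*w^3 + 1/3*m^5*w^4 +
      1/3*m^6 + 1/3*m^6*w - 2/3*m^6*w^2)*r8 + (2/3*m - 1/3*m*w - m*w^2 + 4/3*m*w^3 + m^2*w -
      1/3*m^2*w^2 - m^2*w^3 - 4/3*m^3 - 2/3*m^3*w + 4/3*m^3*w^2 + m^4 - m^4*w + 1/3*m^4*w^2 -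
      1/3*m^5 + m^5*w - 1/3*m^5*w^2 - 1/3*m^5*w^3)*r0 + (1/3*m*w^2 + 2/3*m*w^3 - 2/3*m^2*w^2 +
      1/3*m^2*w^3 - 1/3*m^2*w^4 + 1/3*m^3*w^2 - 1/3*m^3*w^3 + 1/3*m^3*w^4 - 1/3*m^4*w^2 +
      2/3*m^4*w^3 - 2/3*m^4*w^4 + 1/3*m^5*w^2 - 1/3*m^5*w^3 - 1/3*m^5*w^4)*r7 + (-1/3*m*w^3 -
      1/3*m*w^4 + 2/3*m^2*w^3 - 1/3*m^2*w^4 + 2/3*m^2*w^5 - m^3*w^3 - 2/3*m^3*w^4 + 2/3*m^3*w^5 +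
      1/3*m^4*w^3 - 2/3*m^4*w^4 + 1/3*m^4*w^5 + 1/3*m^5*w^3 + 1/3*m^5*w^5)*r5)*hw
  have hb2 : r3 - r5 = 0 := by
    refine (mul_eq_zero_iff_left (a := (m - 1)*(m - w)*(m + w))
      (mul_ne_zero (mul_ne_zero k1 k3) k4)).1 ?_
    linear_combination (-m + m*w + m^2 - m^2*w)*ha1 + (-1 + m + m^2 - m^3)*hc2 +
      (2*m + m*w - 2*m^2 - m^2*w)*hb1 + (-w + m + m^2*w - m^3)*ha2 + (m)*e1 + (-w)*e2 +
      ((1 - w - m + m*w - m^2 + m^2*w + m^3 - m^3*w)*r6 + (-1 + w + m - m*w + m*w^3 - m*w^4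
      + m^2 - m^2*w - m^3 + m^3*w)*r8 + (w^2 - w^3 - 2*m + m*w + m^2 - m^2*w^2 + m^2*w^3 + m^3 -
      m^3*w)*r3 + (-w^2 + w^3 + m*w^2 - m*w^3 + m^2 - m^2*w + m^2*w^3 - m^2*w^4 - m^3 + m^3*w)*r5
      + (2*m - m*w - m*w^2 + m*w^3 - 2*m^2 + m^2*w + m^2*w^2 - 2*m^2*w^3 + m^2*w^4)*r4 + (-m*w^3 +
      m*w^4)*r7)*hw
  have hc1 : r6 - r7 = 0 := by
    refine (mul_eq_zero_iff_left (a := (m - 1))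
      k1).1 ?_
    linear_combination (-1 + m)*ha1 + (m - m^2)*hc2 + (1 - m)*hb1 + (1 - m^2)*ha2 +
      (m - m^2)*hb2 + (1)*e1 +
      ((-1 + w + m^2 - m^2*w)*r3 + (1 - w - m + m*w - m*w^3 + m*w^4)*r4 + (-1 + w + m^2 -
      m^2*w)*r6 + (1 - w - m + m*w)*r7 + (m - m*w + m*w^3 - m*w^4 - m^2 + m^2*w)*r5 + (m - m*w -
      m^2 + m^2*w)*r8)*hw
  have ht : r0 + (-1 - w)*r6 + w*r3 = 0 := by
    refine (mul_eq_zero_iff_left (a := (m - 1)*(m + 1))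
      (mul_ne_zero k1 k2)).1 ?_
    linear_combination (-m*w + m^2)*ha1 + (-m - m*w)*hc2 + (-m*w)*hb1 +
      (1 + m + 2*m*w - m^2)*ha2 + (1 + m^2*w)*hb2 + (1 + w - m^2)*hc1 + (-w)*e4 +
      ((-1 + w - m)*r1 + (-1 + w^2 - w^3)*r3 + (1 - w + m^2*w - m^2*w^2)*r5 + (1 - w^2 + w^3
      - m^2 + m^2*w)*r7 + (m + m*w - m*w^2)*r0 + (m - m^2*w + m^2*w^2)*r6 + (-m + m*w^2 - m*w^3 +
      m*w^4)*r8 + (-m*w + m*w^3 - m*w^4)*r4 + (m^2 - m^2*w)*r2)*hw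
  refine ⟨?_, ?_, ?_, ?_, ?_, ?_, ?_⟩
  · linear_combination ha2
  · linear_combination ha2 - ha1
  · linear_combination -hb1
  · linear_combination -hb2
  · linear_combination -hc1
  · linear_combination -hc2
  · linear_combination ht + r6*hw

/-- The same elimination when the kernel line of `χ` carries the entry `-w`. The additional pivots
are `m ^ 2 + 1` and a quartic, which `quartic_ne_zero` excludes on the unit circle. -/
theorem span_of_kernel_line_omega {m w r0 r1 r2 r3 r4 r5 r6 r7 r8 : ℂ}
    (hw : w^2 + w + 1 = 0)
    (m0 : m ≠ 0) (k3 : m - w ≠ 0) (k4 : m + w ≠ 0) (k5 : m - w^2 ≠ 0) (k6 : m + w^2 ≠ 0) (k7 : m^2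
      + 1 ≠ 0) (q0 : m^4 + 3*(1 + 2*w)*m^2 - 1 ≠ 0)
    (e1 : -m*w*(r1 - r0) + m*w^3*(r2 - r1) - m*w^2*(r0 - r2) - m*w^2*(r4 - r3) + w^4*(r5 - r4) -
      m^2*w^3*(r3 - r5) - w^3*(r7 - r6) + m^2*w^2*(r8 - r7) - m*w*(r6 - r8) = 0)
    (e2 : -m*w*(r2 - r0) - m*w^2*(r0 - r1) + m*w^3*(r1 - r2) - w^4*(r5 - r3) - m*w^2*(r3 - r4) +
      m^2*w^3*(r4 - r5) - m*w*(r8 - r6) - m^2*w^2*(r6 - r7) + w^3*(r7 - r8) = 0)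
    (e3 : m^2*(r3 - r0) + m^2*w^2*(r4 - r1) + m*w^4*(r5 - r2) + m*w^2*(r6 - r3) + w^4*(r7 - r4) +
      m^2*w^3*(r8 - r5) + w*(r0 - r6) + m*w^3*(r1 - r7) + w^2*(r2 - r8) = 0)
    (e4 : -m^2*(r4 - r0) + m*w^4*(r5 - r1) - m^2*w^2*(r3 - r2) - w^4*(r7 - r3) + m*w^2*(r8 - r4) -
      m^2*w^3*(r6 - r5) - w^2*(r1 - r6) + m*w^3*(r2 - r7) - w*(r0 - r8) = 0)
    (e5 : -m*w^2*(r5 - r0) - m^2*w^2*(r3 - r1) + m^2*w^2*(r4 - r2) - m*w^2*(r8 - r3) - m*w^2*(r6 -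
      r4) + m*w^5*(r7 - r5) - w^2*(r2 - r6) - m*w^2*(r0 - r7) + w^2*(r1 - r8) = 0)
    (e6 : m^2*(r6 - r0) + m*w^4*(r7 - r1) + m^2*w^2*(r8 - r2) + w^2*(r0 - r3) + w^3*(r1 - r4) +
      m*w^4*(r2 - r5) + m*w*(r3 - r6) + m^2*w^2*(r4 - r7) + w^3*(r5 - r8) = 0)
    (e7 : -m*w^2*(r7 - r0) + m^2*w^2*(r8 - r1) - m^2*w^2*(r6 - r2) - w^3*(r1 - r3) + w^3*(r2 - r4)
      - m*w^3*(r0 - r5) - m*w*(r4 - r6) + m*w^4*(r5 - r7) - m*w*(r3 - r8) = 0)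
    (e8 : -m^2*(r8 - r0) - m^2*w^2*(r6 - r1) + m*w^4*(r7 - r2) - w^3*(r2 - r3) - w^2*(r0 - r4) +
      m*w^4*(r1 - r5) - w^3*(r5 - r6) - m^2*w^2*(r3 - r7) + m*w*(r4 - r8) = 0) :
    r1 = r0 ∧ r2 = r0 ∧ r4 = r3 ∧ r5 = r3 ∧ r7 = r6 ∧ r8 = r6 ∧ r0 + w*r3 + w^2*r6 = 0 := by
  have ha1 : r1 - r2 = 0 := by
    refine (mul_eq_zero_iff_left (a := m*(m - w)*(m + w))
      (mul_ne_zero (mul_ne_zero m0 k3) k4)).1 ?_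
    linear_combination (2/9*w - 1/9*m - 2/9*m*w + 2/9*m^2 + 2/9*m^2*w)*e6 +
      (-2/9*m - 4/9*m*w)*e7 + (-2/9*w - 1/9*m - 2/9*m*w - 2/9*m^2 - 2/9*m^2*w)*e8 +
      (-2/9 + 2/9*m + 1/9*m*w - 2/9*m^2 - 2/9*m^2*w)*e1 +
      (2/9 + 2/9*m + 1/9*m*w + 2/9*m^2 + 2/9*m^2*w)*e2 +
      (2/9 + 2/9*w + 1/9*m - 1/9*m*w - 2/9*m^2 - 2/9*m^2*w)*e3 +
      (-2/9 - 2/9*w + 1/9*m - 1/9*m*w + 2/9*m^2 + 2/9*m^2*w)*e4 +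
      ((-4/9*w + 4/9*m^2 + 4/9*m^2*w - 4/9*m^2*w^2)*r0 + (2/9*w + 2/9*w^2 - 1/3*m*w +
      1/9*m*w^2 - 1/3*m^2*w + 2/9*m^2*w^2 + 1/9*m^3 - 1/9*m^3*w - 1/9*m^3*w^2 - 2/9*m^4 +
      2/9*m^4*w^2)*r6 + (2/9*w + 2/9*w^2 + 1/3*m*w - 1/9*m*w^2 - 1/3*m^2*w + 2/9*m^2*w^2 - 1/9*m^3
      + 1/9*m^3*w + 1/9*m^3*w^2 - 2/9*m^4 + 2/9*m^4*w^2)*r8 + (-2/9*w^2 - 2/9*m*w - 8/9*m*w^2 +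
      2/9*m*w^3 + 2/9*m^2*w + 1/9*m^2*w^2 - 1/9*m^2*w^3 + m^3 - 11/9*m^3*w - 2/9*m^3*w^2 +
      2/3*m^3*w^3)*r1 + (-2/9*w^2 + 2/9*m*w + 8/9*m*w^2 - 2/9*m*w^3 + 2/9*m^2*w + 1/9*m^2*w^2 -
      1/9*m^2*w^3 - m^3 + 11/9*m^3*w + 2/9*m^3*w^2 - 2/3*m^3*w^3)*r2 + (2/9*w^3 + 1/3*m*w^2 -
      2/9*m^2 - 1/9*m^2*w + 2/9*m^2*w^2 - 4/9*m^2*w^3 - 1/9*m^3 + 1/9*m^3*w^2 + 2/9*m^4 -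
      2/9*m^4*w^2)*r3 + (2/9*w^3 - 1/3*m*w^2 - 2/9*m^2 - 1/9*m^2*w + 2/9*m^2*w^2 - 4/9*m^2*w^3 +
      1/9*m^3 - 1/9*m^3*w^2 + 2/9*m^4 - 2/9*m^4*w^2)*r4 + (-4/9*w^3 - 2/3*m^2*w^2 +
      4/9*m^2*w^3)*r7 + 2/3*m^2*w^3*r5)*hw
  have hc2 : r6 - r8 = 0 := by
    refine (mul_eq_zero_iff_left (a := (m - w^2)*(m + w^2)*(m^4 + 3*(1 + 2*w)*m^2 - 1))
      (mul_ne_zero (mul_ne_zero k5 k6) q0)).1 ?_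
    linear_combination (-1 - 2*w - 5*m^2 - 8*m^2*w - 6*m^4 - 4*m^4*w - m^6*w)*ha1 +
      (-1/3*w - 1/3*m + 1/3*m*w + 4/3*m^2 + 2/3*m^2*w - 1/3*m^3 - 2/3*m^3*w + 1/3*m^4*w)*e3 +
      (-1/3*w + 1/3*m - 1/3*m*w + 4/3*m^2 + 2/3*m^2*w + 1/3*m^3 + 2/3*m^3*w + 1/3*m^4*w)*e4 +
      (-1 - 1/3*w - 5/3*m^2 + 2/3*m^2*w - 1/3*m^4 - 1/3*m^4*w)*e5 +
      (1/3*w - 1/3*m + 1/3*m*w + 4/3*m^2 + 5/3*m^2*w - 1/3*m^3 + 1/3*m^3*w - 1/3*m^4*w)*e6 +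
      (-2/3*w + 4/3*m^2 - 4/3*m^2*w + 2/3*m^4)*e7 +
      (1/3*w + 1/3*m - 1/3*m*w + 4/3*m^2 + 5/3*m^2*w + 1/3*m^3 - 1/3*m^3*w - 1/3*m^4*w)*e8 +
      ((1 + w - w^2 + 1/3*m*w^2 - 1/3*m*w^3 + 5*m^2 + 3*m^2*w - 4*m^2*w^2 + 1/3*m^2*w^3 -
      1/3*m^3*w^2 + 2/3*m^3*w^3 + 6*m^4 - 2*m^4*w - 2/3*m^4*w^2 + 4/3*m^4*w^3 - 2/3*m^5*w^2 +
      1/3*m^5*w^3 + m^6*w)*r1 + (-1 - w + w^2 + 1/3*m*w^2 - 1/3*m*w^3 - 5*m^2 - 3*m^2*w +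
      4*m^2*w^2 - 1/3*m^2*w^3 - 1/3*m^3*w^2 + 2/3*m^3*w^3 - 6*m^4 + 2*m^4*w + 2/3*m^4*w^2 -
      4/3*m^4*w^3 - 2/3*m^5*w^2 + 1/3*m^5*w^3 - m^6*w)*r2 + (2/3*w^2 - 1/3*m*w + 1/3*m*w^2 - m^2 +
      5/3*m^2*w + m^2*w^2 - 6*m^2*w^3 + 1/3*m^3 - m^3*w + 5/3*m^4 + 7/3*m^4*w + 1/3*m^5 -
      4/3*m^5*w + 2/3*m^5*w^2 + m^6 - 2/3*m^6*w + 1/3*m^6*w^2)*r6 + (-2/3*w^2 - 1/3*m*w +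
      1/3*m*w^2 + m^2 - 5/3*m^2*w - m^2*w^2 + 6*m^2*w^3 + 1/3*m^3 - m^3*w - 5/3*m^4 - 7/3*m^4*w +
      1/3*m^5 - 4/3*m^5*w + 2/3*m^5*w^2 - m^6 + 2/3*m^6*w - 1/3*m^6*w^2)*r8 + (1/3*w^3 - 1/3*m*w^2
      + 1/3*m*w^3 + 2/3*m^2*w - m^2*w^2 - 2/3*m^2*w^3 + 1/3*m^3 - 2/3*m^3*w + 2/3*m^3*w^2 -
      2/3*m^3*w^3 - 4/3*m^4 + m^4*w + 2/3*m^4*w^2 - 1/3*m^4*w^3 + 1/3*m^5 + m^5*w - 1/3*m^6*w)*r3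
      + (-1/3*w^3 - 1/3*m*w^2 + 1/3*m*w^3 - 2/3*m^2*w + m^2*w^2 + 2/3*m^2*w^3 + 1/3*m^3 -
      2/3*m^3*w + 2/3*m^3*w^2 - 2/3*m^3*w^3 + 4/3*m^4 - m^4*w - 2/3*m^4*w^2 + 1/3*m^4*w^3 +
      1/3*m^5 + m^5*w + 1/3*m^6*w)*r4 + (2/3*m*w - 2/3*m*w^2 - 4/3*m^3 + 10/3*m^3*w - 4/3*m^3*w^2
      - 4/3*m^5 + 2/3*m^5*w)*r0 + (-m*w^2 + 4/3*m*w^3 - 1/3*m*w^4 - 5/3*m^3*w^2 + m^3*w^3 +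
      2/3*m^3*w^4 - 1/3*m^5*w^2 - 4/3*m^5*w^3 - 1/3*m^5*w^4)*r5 + (m*w^2 - 4/3*m*w^3 + 1/3*m*w^4 +
      7/3*m^3*w^2 - m^3*w^3 - 2/3*m^3*w^4 + 1/3*m^5*w^2 + 2/3*m^5*w^3 + 1/3*m^5*w^4)*r7)*hw
  have hb1 : r3 - r4 = 0 := by
    refine (mul_eq_zero_iff_left (a := (m - w^2)*(m + w^2))
      (mul_ne_zero k5 k6)).1 ?_
    linear_combination (1 + w + m^2)*ha1 + (1 + w + m^2*w)*hc2 + (1/3 - 1/3*w)*e5 +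
      (-1/3 - 2/3*w)*e6 + (-1/3 - 2/3*w)*e8 +
      ((-1 + 2/3*w^2 - m^2 + m^2*w)*r1 + (1 - 2/3*w^2 + m^2 - m^2*w)*r2 + (-1 + 2/3*w^2 -
      1/3*m*w + 1/3*m^2 - 2/3*m^2*w)*r6 + (1 - 2/3*w^2 - 1/3*m*w - 1/3*m^2 + 2/3*m^2*w)*r8 +
      (-1/3*w^2 + 1/3*m*w + m^2 - m^2*w)*r3 + (1/3*w^2 + 1/3*m*w - m^2 + m^2*w)*r4 + (1/3*m*w^2 -
      2/3*m*w^3 - 1/3*m*w^4)*r5 + (-1/3*m*w^2 + 2/3*m*w^3 + 1/3*m*w^4)*r7)*hw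
  have ha2 : (-1)*r0 + r1 = 0 := by
    refine (mul_eq_zero_iff_left (a := m)
      m0).1 ?_
    linear_combination (1/2*m)*ha1 + (-1/6 - 1/3*w + 1/6*m^2 - 1/6*m^2*w)*hc2 +
      (1/3 + 1/6*w + 1/6*m^2 + 1/3*m^2*w)*hb1 + (1/6 + 1/3*w)*e1 + (1/6 + 1/3*w)*e2 +
      ((-1/3 + 1/6*w + 1/6*w^2 - 1/3*w^3 - 1/6*m^2 - 1/6*m^2*w + 1/3*m^2*w^2)*r3 + (1/3 -
      1/6*w - 1/6*w^2 + 1/3*w^3 + 1/6*m^2 + 1/6*m^2*w - 1/3*m^2*w^2)*r4 + (1/6 + 1/6*w - 1/3*w^2 -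
      1/6*m^2 + 1/3*m^2*w)*r6 + (-1/6 - 1/6*w + 1/3*w^2 + 1/6*m^2 - 1/3*m^2*w)*r8 + (-m +
      2/3*m*w)*r0 + (1/2*m - 1/3*m*w)*r1 + (1/2*m - 1/3*m*w)*r2)*hw
  have hb2 : r3 - r5 = 0 := by
    refine (mul_eq_zero_iff_left (a := m*(m^2 + 1))
      (mul_ne_zero m0 k7)).1 ?_
    linear_combination (-1/3 - 1/6*w + 1/6*m - 1/6*m*w - 5/6*m^2 - 2/3*m^2*w + 1/3*m^3 +
      1/6*m^3*w - 1/3*m^4 - 1/6*m^4*w)*ha1 +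
      (-1/2 + 1/6*w + 1/3*m^2 + 5/6*m^2*w + 1/6*m^4)*hc2 +
      (1/6 + 1/2*m - 5/6*m^2*w + 1/2*m^3 - 1/6*m^4 - 1/6*m^4*w)*hb1 +
      (-1/3*m + 1/3*m*w - 2/3*m^3 - 1/3*m^3*w)*ha2 +
      (1/6 + 1/6*w + 1/3*m + 1/6*m*w + 1/6*m^2)*e3 +
      (1/6 + 1/6*w - 1/3*m - 1/6*m*w + 1/6*m^2)*e4 + (1/3*w + 1/6*m^2*w)*e5 +
      ((1/3 - 1/6*w + 1/6*m - 1/3*m*w - 1/6*m*w^2 + 1/6*m*w^3 + 5/6*m^2 - 1/6*m^2*w -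
      1/3*m^2*w^2 - 1/6*m^2*w^3 + 1/3*m^3 - 1/6*m^3*w + 1/6*m^3*w^2 + 1/3*m^4 - 1/6*m^4*w)*r1 +
      (-1/3 + 1/6*w + 1/6*m - 1/3*m*w - 1/6*m*w^2 + 1/6*m*w^3 - 5/6*m^2 + 1/6*m^2*w + 1/3*m^2*w^2
      + 1/6*m^2*w^3 + 1/3*m^3 - 1/6*m^3*w + 1/6*m^3*w^2 - 1/3*m^4 + 1/6*m^4*w)*r2 + (-1/6 + 1/6*w
      - 1/6*w^3 + 1/2*m - 1/2*m*w + 1/6*m*w^2 + 1/6*m*w^3 - 1/6*m^2 + 5/6*m^2*w - 1/6*m^2*w^2 +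
      1/6*m^3 - 1/3*m^3*w + 1/6*m^4*w)*r3 + (1/6 - 1/6*w + 1/6*w^3 + 1/2*m - 1/2*m*w + 1/6*m*w^2 +
      1/6*m*w^3 + 1/6*m^2 - 5/6*m^2*w + 1/6*m^2*w^2 + 1/6*m^3 - 1/3*m^3*w - 1/6*m^4*w)*r4 + (1/2 -
      1/2*w + 1/3*m*w - 1/3*m^2 - 1/3*m^2*w + 1/6*m^2*w^2 - 1/6*m^3*w^2 - 1/6*m^4 + 1/6*m^4*w)*r6
      + (-1/2 + 1/2*w + 1/3*m*w + 1/3*m^2 + 1/3*m^2*w - 1/6*m^2*w^2 - 1/6*m^3*w^2 + 1/6*m^4 -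
      1/6*m^4*w)*r8 + (-1/3*m)*r0 + (-m + m*w - 2/3*m*w^3 + 1/3*m*w^4 - m^3 + m^3*w - 1/6*m^3*w^3
      + 1/6*m^3*w^4)*r5 + (-1/3*m*w^4 + 1/6*m^3*w^3 - 1/6*m^3*w^4)*r7)*hw
  have hc1 : r6 - r7 = 0 := by
    refine (mul_eq_zero_iff_left (a := m)
      m0).1 ?_
    linear_combination (1/2 + 1/2*m^2)*ha1 + (1/2 + 1/2*m)*hc2 + (-1/2*m - 1/2*m^2)*hb1 +
      (m)*hb2 + (-1/2*w)*e5 +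
      ((-1/2 + 1/2*w - 1/2*m^2 + 1/2*m^2*w)*r1 + (1/2 - 1/2*w + 1/2*m^2 - 1/2*m^2*w)*r2 +
      (-1/2 + 1/2*w + 1/2*m - 1/2*m*w)*r6 + (1/2 - 1/2*w + 1/2*m - 1/2*m*w)*r8 + (-1/2*m + 1/2*m*w
      + 1/2*m^2 - 1/2*m^2*w)*r3 + (-1/2*m + 1/2*m*w - 1/2*m^2 + 1/2*m^2*w)*r4 + (m - m*w +
      1/2*m*w^3 - 1/2*m*w^4)*r5 + (-m + m*w - 1/2*m*w^3 + 1/2*m*w^4)*r7)*hw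
  have ht : r0 + (-1 - w)*r6 + w*r3 = 0 := by
    refine (mul_eq_zero_iff_left (a := m)
      m0).1 ?_
    linear_combination (-1/3 + 1/3*w + 2/3*m^2 + 1/3*m^2*w)*ha1 +
      (-1/3*m - 2/3*m*w + 2/3*m^2 + 1/3*m^2*w)*hc2 + (1/3 - 1/3*w + 1/3*m + 2/3*m*w)*hb1 +
      (-2/3*m - 1/3*m*w)*hb2 + (-1/3*m + 1/3*m*w)*hc1 + (-1/3 + 1/3*w)*e7 +
      ((1/3 - 2/3*w + 1/3*w^2 - 2/3*m^2 + 1/3*m^2*w)*r1 + (-1/3 + 2/3*w - 1/3*w^2 + 2/3*m^2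
      - 1/3*m^2*w)*r2 + (-1/3 + 2/3*w - 1/3*w^2 + 1/3*m)*r3 + (1/3 - 2/3*w + 1/3*w^2 + 1/3*m)*r4 +
      (m - m*w + 1/3*m*w^2)*r0 + (-2/3*m + 1/3*m*w + 1/3*m*w^2 - 1/3*m*w^3)*r5 + (-1/3*m - 2/3*m^2
      + 1/3*m^2*w)*r6 + (-1/3*m + 2/3*m*w - 2/3*m*w^2 + 1/3*m*w^3)*r7 + (-1/3*m + 2/3*m^2 -
      1/3*m^2*w)*r8)*hw
  refine ⟨?_, ?_, ?_, ?_, ?_, ?_, ?_⟩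
  · linear_combination ha2
  · linear_combination ha2 - ha1
  · linear_combination -hb1
  · linear_combination -hb2
  · linear_combination -hc1
  · linear_combination -hc2
  · linear_combination ht + r6*hw

/-- At the trivial character the equations force `r` to be even and to satisfy the linearisation of
`x + y + u + w = 1` and its conjugate. Five line values with two relations leave three free ones,
which `z0, z1, z3` set to zero. -/
theorem eq_zero_of_trivial_character {m w r0 r1 r2 r3 r4 r5 r6 r7 r8 : ℂ}
    (hw : w^2 + w + 1 = 0)
    (m0 : m ≠ 0) (k1 : m - 1 ≠ 0) (k2 : m + 1 ≠ 0) (k3 : m - w ≠ 0) (k4 : m + w ≠ 0)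
    (z0 : r0 = 0) (z1 : r1 = 0) (z3 : r3 = 0)
    (e1 : m^2*(r1 - r0) + m*(r2 - r1) + (r0 - r2) + w*(r4 - r3) + m*w^4*(r5 - r4) + m^2*w*(r3 -
      r5) + w^2*(r7 - r6) + m*w^2*(r8 - r7) + m^2*w^2*(r6 - r8) = 0)
    (e2 : m^2*(r2 - r0) + (r0 - r1) + m*(r1 - r2) + w^2*(r5 - r3) + m^2*w^2*(r3 - r4) + m*w^2*(r4
      - r5) + w*(r8 - r6) + m^2*w*(r6 - r7) + m*w^4*(r7 - r8) = 0)
    (e3 : -m^2*(r3 - r0) - w*(r4 - r1) - w^2*(r5 - r2) + m*(r6 - r3) + m*w^4*(r7 - r4) + m*w^2*(r8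
      - r5) - (r0 - r6) - m^2*w*(r1 - r7) - m^2*w^2*(r2 - r8) = 0)
    (e4 : -m*w*(r4 - r0) - w^2*(r5 - r1) - m*(r3 - r2) + w^2*(r7 - r3) + m*w^3*(r8 - r4) +
      m^2*w*(r6 - r5) - m*(r1 - r6) - m^2*w*(r2 - r7) - m*w^2*(r0 - r8) = 0)
    (e5 : -m*w^2*(r5 - r0) - m*(r3 - r1) - w*(r4 - r2) + w*(r8 - r3) + m^2*w^2*(r6 - r4) +
      m*w^3*(r7 - r5) - m*(r2 - r6) - m*w*(r0 - r7) - m^2*w^2*(r1 - r8) = 0)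
    (e6 : -m^2*(r6 - r0) - w^2*(r7 - r1) - w*(r8 - r2) - (r0 - r3) - m^2*w^2*(r1 - r4) - m^2*w*(r2
      - r5) + m*(r3 - r6) + m*w^2*(r4 - r7) + m*w^4*(r5 - r8) = 0)
    (e7 : -m*w^2*(r7 - r0) - w*(r8 - r1) - m*(r6 - r2) - m*(r1 - r3) - m^2*w^2*(r2 - r4) - m*w*(r0
      - r5) + w*(r4 - r6) + m*w^3*(r5 - r7) + m^2*w^2*(r3 - r8) = 0)
    (e8 : -m*w*(r8 - r0) - m*(r6 - r1) - w^2*(r7 - r2) - m*(r2 - r3) - m*w^2*(r0 - r4) - m^2*w*(r1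
      - r5) + w^2*(r5 - r6) + m^2*w*(r3 - r7) + m*w^3*(r4 - r8) = 0) :
    r0 = 0 ∧ r1 = 0 ∧ r2 = 0 ∧ r3 = 0 ∧ r4 = 0 ∧ r5 = 0 ∧ r6 = 0 ∧ r7 = 0 ∧ r8 = 0 := by
  have ha : r1 - r2 = 0 := by
    refine (mul_eq_zero_iff_left (a := (m - 1)*(m - 1)*(m + 1)*(m + 1))
      (mul_ne_zero (mul_ne_zero (mul_ne_zero k1 k1) k2) k2)).1 ?_
    linear_combination (-1/3*w - 1/3*m + 1/3*m^2 + 1/3*m^2*w)*e3 +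
      (1/3*w + 1/3*m - 1/3*m^2 - 1/3*m^2*w)*e4 + (1/3 + 1/3*w - 1/3*m - 1/3*m^2*w)*e6 +
      (-1/3 - 1/3*w + 1/3*m + 1/3*m^2*w)*e7 + (1/3 + 1/3*m + 1/3*m^2)*e1 +
      ((1 - 2/3*w - 4/3*m^2 + m^2*w - 1/3*m^3 + 2/3*m^4 - 1/3*m^4*w)*r1 + (-2/3 + 1/3*w +
      1/3*m + 4/3*m^2 - m^2*w - m^4 + 2/3*m^4*w)*r2 + (-1/3 + 1/3*w + 1/3*m - 1/3*m^3 + 1/3*m^4 -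
      1/3*m^4*w)*r3 + (-m + 2/3*m*w + m^3 - 2/3*m^3*w)*r0 + (1/3*m - 1/3*m^3)*r6 + (-m*w + m*w^2 -
      1/3*m*w^3 + 1/3*m^2*w - 1/3*m^3*w + 1/3*m^3*w^3)*r4 + (1/3*m*w - 1/3*m*w^3 - 1/3*m^2*w +
      m^3*w - m^3*w^2 + 1/3*m^3*w^3)*r5 + (-2/3*m*w^2 + 1/3*m*w^3 + 1/3*m^2*w^2 + 1/3*m^3*w^2 -
      1/3*m^3*w^3)*r7 + (-1/3*m*w^2 + 1/3*m*w^3 - 1/3*m^2*w^2 + 2/3*m^3*w^2 - 1/3*m^3*w^3)*r8)*hw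
  -- This is `m` times the conjugate of the linearised constraint; as `r` is complex, it is
  -- independent of `hp`.
  have hq : r1 - r3 + (-m)*r0 + (m + m*w)*r4 + (-m*w)*r5 = 0 := by
    refine (mul_eq_zero_iff_left (a := (m - 1)*(m + 1))
      (mul_ne_zero k1 k2)).1 ?_
    linear_combination (w - m^2*w)*ha + (2/3 - 1/3*m)*e6 + (-1/3 - 1/3*m)*e7 + (-1/3 - 1/3*m)*e8 +
      (1/3 + 1/3*m)*e1 + (1/3 + 1/3*m)*e2 +
      ((-2/3 + 1/3*m + 2/3*m^2 - 1/3*m^3)*r1 + (1/3 + 1/3*m - 1/3*m^2 - 1/3*m^3)*r2 + (1/3 +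
      1/3*m)*r3 + (-m + 1/3*m*w^2 + 1/3*m^2*w^2 + m^3)*r4 + (4/3*m*w - m*w^2 + 1/3*m^2*w)*r5 +
      (-4/3*m*w + m*w^2 - 1/3*m^2*w)*r8 + (-1/3*m*w^2 - 1/3*m^2*w^2)*r7 + (-1/3*m^2 -
      1/3*m^3)*r6)*hw
  -- The linearised constraint `m(r1 - r0) - m(r3 - r0) - w(r4 - r0) - w²(r5 - r0) = 0`, with `w²`
  -- eliminated.
  have hp : (-1)*r0 + (1 + w)*r5 + (-w)*r4 + m*r1 + (-m)*r3 = 0 := by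
    refine (mul_eq_zero_iff_left (a := (m - 1)*(m + 1))
      (mul_ne_zero k1 k2)).1 ?_
    linear_combination (-2*w - m - m*w + 2*m^2*w + m^3 + m^3*w)*ha + (-2 + 2*m^2)*hq + (m)*e3 +
      (-1 - m)*e4 + (-1 - m)*e5 + (-1 + m)*e6 +
      ((2 - 2*m^2)*r1 + (-1 - m)*r3 + (-1 - 2*m*w + m*w^2 + m^2 - m^2*w^2)*r5 + (-m +
      m^3)*r2 + (2*m - m*w - 2*m^2*w + m^2*w^2 - 2*m^3)*r4 + (m*w + 2*m^2*w - m^2*w^2)*r7 + (2*m*w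
      - m*w^2 + m^2*w^2)*r8 + (m^2 + m^3)*r6)*hw
  have hc : r4 - r8 = 0 := by
    refine (mul_eq_zero_iff_left (a := (m - 1)*(m + 1)*(m - w))
      (mul_ne_zero (mul_ne_zero k1 k2) k3)).1 ?_
    linear_combination (w + 2*m - m^2*w + m^3*w)*ha + (2 + w - m - m*w - m^2)*hq + (-1 + m*w)*hp +
      (1)*e4 + (-m*w)*e5 + (1 - m)*e6 +
      ((-2 + m + m^2 - m^3*w)*r1 + (1 - m)*r3 + (1 + m*w - m*w^2 - m^2*w)*r5 + (m - 2*m^2 +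
      m^2*w)*r0 + m*r2 + (-3*m + m*w + m^2 + 2*m^3 - m^3*w)*r4 + (m - 2*m*w + m*w^2 + m^2*w -
      m^2*w^2 - m^3 + m^3*w)*r8 + (-m^2*w + m^2*w^2)*r7 + (-m^3 + m^3*w)*r6)*hw
  have hd : r5 - r7 = 0 := by
    refine (mul_eq_zero_iff_left (a := (m - 1)*(m - 1))
      (mul_ne_zero k1 k1)).1 ?_
    linear_combination (w + m - m^2 - m^2*w)*ha + (-1 - 2*w + m + 2*m*w)*hq +
      (-1 - 2*w + m + 2*m*w)*hp + (1 - 2*m + m^2)*hc + (-w)*e1 + (-1 - w)*e2 +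
      ((-1 - w + m^2 + m^2*w)*r3 + (-1 + 3*m + m*w + m*w^2 - m*w^3 - 2*m^2 - m^2*w)*r4 + (2
      + w - 3*m - m*w - m*w^2 + m*w^3 + m^2)*r5 + (-1 + w + 2*m - 2*m*w + m*w^3 - m^2)*r7 + (1 -
      2*m + 2*m*w - m*w^3 + m^2 - m^2*w)*r8 + (-w + m^2*w)*r6)*hw
  have hb : r3 - r6 = 0 := by
    refine (mul_eq_zero_iff_left (a := (m + w))
      k4).1 ?_
    linear_combination (m + m^2 + m^2*w)*ha + (-w)*hq + (-m - m*w)*hp + (-w + m^2 + m^2*w)*hc +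
      (m*w)*hd + (1)*e7 +
      ((-m)*r0 + (m - m*w)*r5 + m*w*r7 + m^2*r2 + (-m^2)*r3 + (-m^2)*r4 + m^2*r8)*hw
  -- Now `hq` and `hp` form a 2×2 system in `r4, r5` with determinant `m(1 + 2w)`; since `(1 + 2w)²
  -- = -3`, clearing it leaves the factor `3m`.
  have hr5 : r5 = 0 := by
    have h3 : 3*m*r5 = 0 := by
      clear e1 e2 e3 e4 e5 e6 e7 e8
      grind
    simpa [m0] using h3
  have hr4 : r4 = 0 := by
    clear e1 e2 e3 e4 e5 e6 e7 e8
    grind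
  refine ⟨z0, z1, ?_, z3, hr4, hr5, ?_, ?_, ?_⟩
  · linear_combination z1 - ha
  · linear_combination z3 - hb
  · linear_combination hr5 - hd
  · linear_combination hr4 - hc

/-! ### Functions on `(ℤ/3)²` and the mode equations -/

/-- The group `ℤ/3 × ℤ/3` indexing rows and columns of block circulant matrices. -/
abbrev G := ZMod 3 × ZMod 3

/-- The even function on `G` with value `a` at `0` and constant values on the four punctured
lines through the origin. -/
def lineFn {α : Type*} (a x y u w : α) : G → α := fun s =>
  if s = 0 then a else if s.1 = 0 then x else if s.2 = 0 then y else if s.1 = s.2 then u else w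

section LineFn

variable {α β : Type*} (a x y u w : α)

theorem lineFn_00 : lineFn a x y u w (0, 0) = a := rfl
theorem lineFn_01 : lineFn a x y u w (0, 1) = x := rfl
theorem lineFn_02 : lineFn a x y u w (0, 2) = x := rfl
theorem lineFn_10 : lineFn a x y u w (1, 0) = y := rfl
theorem lineFn_11 : lineFn a x y u w (1, 1) = u := rfl
theorem lineFn_12 : lineFn a x y u w (1, 2) = w := rfl
theorem lineFn_20 : lineFn a x y u w (2, 0) = y := rfl
theorem lineFn_21 : lineFn a x y u w (2, 1) = w := rfl
theorem lineFn_22 : lineFn a x y u w (2, 2) = u := rfl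

theorem comp_lineFn (F : α → β) (s : G) :
    F (lineFn a x y u w s) = lineFn (F a) (F x) (F y) (F u) (F w) s := by
  simp only [lineFn]
  split_ifs <;> rfl

end LineFn

theorem forall_G {p : G → Prop} : (∀ s, p s) ↔ p (0, 0) ∧ p (0, 1) ∧ p (0, 2) ∧ p (1, 0) ∧
    p (1, 1) ∧ p (1, 2) ∧ p (2, 0) ∧ p (2, 1) ∧ p (2, 2) := by
  refine ⟨fun h => ⟨h _, h _, h _, h _, h _, h _, h _, h _, h _⟩, ?_⟩
  rintro ⟨h0, h1, h2, h3, h4, h5, h6, h7, h8⟩ ⟨k, l⟩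
  fin_cases k <;> fin_cases l <;> assumption

theorem sum_G {M : Type*} [AddCommMonoid M] (F : G → M) :
    ∑ s, F s = F (0, 0) + F (0, 1) + F (0, 2) + F (1, 0) + F (1, 1) + F (1, 2) +
      F (2, 0) + F (2, 1) + F (2, 2) := by
  rw [Fintype.sum_prod_type]
  change ∑ x : Fin 3, ∑ y : Fin 3, F (x, y) = _
  simp only [Fin.sum_univ_three, ← add_assoc]
  rfl

theorem zmod_one_add_one : (1 + 1 : ZMod 3) = 2 := rfl
theorem zmod_one_add_two : (1 + 2 : ZMod 3) = 0 := rfl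
theorem zmod_two_add_one : (2 + 1 : ZMod 3) = 0 := rfl
theorem zmod_two_add_two : (2 + 2 : ZMod 3) = 1 := rfl
theorem zmod_neg_one : (-1 : ZMod 3) = 2 := rfl
theorem zmod_neg_two : (-2 : ZMod 3) = 1 := rfl

/-- The equations satisfied by the Fourier coefficients `r` at the character `χ` of a real matrix
in the kernel of the derivative of unitarity, for the group matrix of `f` and `g = conj f`. -/
def IsModeSolution (g f : G → ℂ) (χ : AddChar G ℂ) (r : G → ℂ) : Prop :=
  ∀ d, ∑ s, g s * f (s + d) * (r (s + d) - r s) * χ (-s) = 0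

namespace IsModeSolution

variable {g f r : G → ℂ} {χ : AddChar G ℂ}

theorem comp (h : IsModeSolution g f χ r) (φ : G ≃+ G) :
    IsModeSolution (g ∘ φ) (f ∘ φ) (χ.compAddMonoidHom φ.toAddMonoidHom) (r ∘ φ) := by
  intro d
  have := h (φ d)
  rw [← φ.toEquiv.sum_comp] at this
  simpa using this

/-- Substituting `s + d` for `s` in the equation at `-d` exchanges the two functions, up to the
nonzero factor `-χ (-d)`. This handles the conjugate of a case already treated. -/
theorem swap (h : IsModeSolution g f χ r) : IsModeSolution f g χ r := by
  intro d
  have := h (-d)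
  rw [← Equiv.sum_comp (Equiv.addRight d)
    (fun s => g s * f (s + -d) * (r (s + -d) - r s) * χ (-s))] at this
  simp only [Equiv.coe_addRight, add_neg_cancel_right, neg_add, AddChar.map_add_eq_mul] at this
  have hd : χ (-d) ≠ 0 := by
    intro h0
    have := χ.map_add_eq_mul d (-d)
    simp [h0] at this
  have h2 : (∑ s, f s * g (s + d) * (r (s + d) - r s) * χ (-s)) * (-χ (-d)) = 0 := by
    rw [Finset.sum_mul, ← this]
    exact Finset.sum_congr rfl fun s _ => by ring
  simpa [hd] using h2

/-- Used with `k = m` to clear the conjugate of `m`, so that the equations become polynomial in `m`.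
-/
theorem smul (h : IsModeSolution g f χ r) (k : ℂ) : IsModeSolution (fun s => k * g s) f χ r := by
  intro d
  have := congrArg (k * ·) (h d)
  simp only [Finset.mul_sum, mul_zero] at this
  rw [← this]
  exact Finset.sum_congr rfl fun s _ => by ring

end IsModeSolution

theorem addChar_snd_trivial {χ : AddChar G ℂ} (h01 : χ (0, 1) = 1) (k l : ZMod 3) :
    χ (k, l) = χ (k, 0) := by
  have h02 : χ (0, 2) = 1 := by
    rw [show ((0, 2) : G) = (0, 1) + (0, 1) from rfl, χ.map_add_eq_mul, h01, one_mul]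
  have hl : χ (0, l) = 1 := by
    fin_cases l
    · exact χ.map_zero_eq_one
    · exact h01
    · exact h02
  rw [show (k, l) = ((k, 0) : G) + (0, l) by simp, χ.map_add_eq_mul, hl, mul_one]

theorem addChar_two_zero (χ : AddChar G ℂ) : χ (2, 0) = χ (1, 0) ^ 2 := by
  rw [show ((2, 0) : G) = (1, 0) + (1, 0) from rfl, χ.map_add_eq_mul, sq]

theorem addChar_zero_two (χ : AddChar G ℂ) : χ (0, 2) = χ (0, 1) ^ 2 := by
  rw [show ((0, 2) : G) = (0, 1) + (0, 1) from rfl, χ.map_add_eq_mul, sq]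

/-! ### The mode equations in coordinates -/

theorem exists_eq_add_mul_addChar {w : ℂ} (hw : w ^ 2 + w + 1 = 0) {χ : AddChar G ℂ}
    (h10 : χ (1, 0) = w) (h01 : χ (0, 1) = 1) {r : G → ℂ}
    (h : r (0, 1) = r (0, 0) ∧ r (0, 2) = r (0, 0) ∧ r (1, 1) = r (1, 0) ∧ r (1, 2) = r (1, 0) ∧
      r (2, 1) = r (2, 0) ∧ r (2, 2) = r (2, 0) ∧ r (0, 0) + w * r (1, 0) + w ^ 2 * r (2, 0) = 0) :
    ∃ A B, ∀ s, r s = A + B * χ s := by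
  obtain ⟨h1, h2, h4, h5, h7, h8, h⟩ := h
  have hw1 : w - 1 ≠ 0 := by
    intro h
    have : w = 1 := sub_eq_zero.1 h
    norm_num [this] at hw
  have hB : (r (1, 0) - r (0, 0)) / (w - 1) * (w - 1) = r (1, 0) - r (0, 0) :=
    div_mul_cancel₀ _ hw1
  -- Interpolation on two cosets of the kernel; the third coset agrees because the `χ⁻¹` component
  -- vanishes.
  set B := (r (1, 0) - r (0, 0)) / (w - 1)
  have e0 : r (0, 0) = r (0, 0) - B + B * 1 := by ring
  have e1 : r (1, 0) = r (0, 0) - B + B * w := by linear_combination -hB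
  have e2 : r (2, 0) = r (0, 0) - B + B * w ^ 2 := by
    linear_combination w * h - (r (2, 0) * (w - 1) + r (1, 0)) * hw - (w + 1) * hB
  have h20 := addChar_two_zero χ
  rw [h10] at h20
  refine ⟨r (0, 0) - B, B, ?_⟩
  rw [forall_G]
  simp only [addChar_snd_trivial h01 _ 1, addChar_snd_trivial h01 _ 2, h1, h2, h4, h5, h7, h8,
    h10, h20, show χ (0, 0) = 1 from χ.map_zero_eq_one]
  exact ⟨e0, e0, e0, e1, e1, e1, e2, e2, e2⟩

theorem modeSolution_expand {g f r : G → ℂ} {χ : AddChar G ℂ} (h : IsModeSolution g f χ r)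
    {w : ℂ} (h10 : χ (1, 0) = w) (h01 : χ (0, 1) = 1) (d : G) :
    g (0, 0) * f d * (r d - r (0, 0)) + g (0, 1) * f ((0, 1) + d) * (r ((0, 1) + d) - r (0, 1)) +
    g (0, 2) * f ((0, 2) + d) * (r ((0, 2) + d) - r (0, 2)) +
    g (1, 0) * f ((1, 0) + d) * (r ((1, 0) + d) - r (1, 0)) * w ^ 2 +
    g (1, 1) * f ((1, 1) + d) * (r ((1, 1) + d) - r (1, 1)) * w ^ 2 +
    g (1, 2) * f ((1, 2) + d) * (r ((1, 2) + d) - r (1, 2)) * w ^ 2 +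
    g (2, 0) * f ((2, 0) + d) * (r ((2, 0) + d) - r (2, 0)) * w +
    g (2, 1) * f ((2, 1) + d) * (r ((2, 1) + d) - r (2, 1)) * w +
    g (2, 2) * f ((2, 2) + d) * (r ((2, 2) + d) - r (2, 2)) * w = 0 := by
  have h20 := addChar_two_zero χ
  rw [h10] at h20
  have e := h d
  rw [sum_G] at e
  simp only [Prod.neg_mk, neg_zero, zmod_neg_one, zmod_neg_two, addChar_snd_trivial h01 _ 1,
    addChar_snd_trivial h01 _ 2, h10, h20, show χ (0, 0) = 1 from χ.map_zero_eq_one] at e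
  rw [show ((0, 0) : G) + d = d from zero_add d] at e
  linear_combination e

theorem modeSolution_line_param {m w : ℂ} (hw : w ^ 2 + w + 1 = 0) {χ : AddChar G ℂ}
    (h10 : χ (1, 0) = w) (h01 : χ (0, 1) = 1) {r : G → ℂ}
    (m0 : m ≠ 0) (k1 : m - 1 ≠ 0) (k2 : m + 1 ≠ 0) (k3 : m - w ≠ 0) (k4 : m + w ≠ 0)
    (k5 : m - w ^ 2 ≠ 0) (k6 : m + w ^ 2 ≠ 0)
    (h : IsModeSolution (lineFn m 1 (-1) (-m * w ^ 2) (-m * w)) (lineFn 1 m (-m) (-w) (-w ^ 2))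
      χ r) :
    ∃ A B, ∀ s, r s = A + B * χ s := by
  have e := modeSolution_expand h h10 h01
  have e1 := e (0, 1)
  have e2 := e (0, 2)
  have e3 := e (1, 0)
  have e4 := e (1, 1)
  have e5 := e (1, 2)
  have e6 := e (2, 0)
  have e7 := e (2, 1)
  have e8 := e (2, 2)
  simp only [Prod.mk_add_mk, zero_add, add_zero, zmod_one_add_one, zmod_one_add_two,
    zmod_two_add_one, zmod_two_add_two, lineFn_00, lineFn_01, lineFn_02, lineFn_10, lineFn_11,
    lineFn_12, lineFn_20, lineFn_21, lineFn_22] at e1 e2 e3 e4 e5 e6 e7 e8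
  refine exists_eq_add_mul_addChar hw h10 h01
    (span_of_kernel_line_param hw m0 k1 k2 k3 k4 k5 k6 ?_ ?_ ?_ ?_ ?_ ?_ ?_ ?_)
  · linear_combination e1
  · linear_combination e2
  · linear_combination e3
  · linear_combination e4
  · linear_combination e5
  · linear_combination e6
  · linear_combination e7
  · linear_combination e8

theorem modeSolution_line_omega {m w : ℂ} (hw : w ^ 2 + w + 1 = 0) {χ : AddChar G ℂ}
    (h10 : χ (1, 0) = w) (h01 : χ (0, 1) = 1) {r : G → ℂ}
    (m0 : m ≠ 0) (k3 : m - w ≠ 0) (k4 : m + w ≠ 0) (k5 : m - w ^ 2 ≠ 0) (k6 : m + w ^ 2 ≠ 0)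
    (k7 : m ^ 2 + 1 ≠ 0) (q0 : m ^ 4 + 3 * (1 + 2 * w) * m ^ 2 - 1 ≠ 0)
    (h : IsModeSolution (lineFn m (-m * w ^ 2) 1 (-1) (-m * w)) (lineFn 1 (-w) m (-m) (-w ^ 2))
      χ r) :
    ∃ A B, ∀ s, r s = A + B * χ s := by
  have e := modeSolution_expand h h10 h01
  have e1 := e (0, 1)
  have e2 := e (0, 2)
  have e3 := e (1, 0)
  have e4 := e (1, 1)
  have e5 := e (1, 2)
  have e6 := e (2, 0)
  have e7 := e (2, 1)
  have e8 := e (2, 2)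
  simp only [Prod.mk_add_mk, zero_add, add_zero, zmod_one_add_one, zmod_one_add_two,
    zmod_two_add_one, zmod_two_add_two, lineFn_00, lineFn_01, lineFn_02, lineFn_10, lineFn_11,
    lineFn_12, lineFn_20, lineFn_21, lineFn_22] at e1 e2 e3 e4 e5 e6 e7 e8
  refine exists_eq_add_mul_addChar hw h10 h01
    (span_of_kernel_line_omega hw m0 k3 k4 k5 k6 k7 q0 ?_ ?_ ?_ ?_ ?_ ?_ ?_ ?_)
  · linear_combination e1
  · linear_combination e2
  · linear_combination e3
  · linear_combination e4
  · linear_combination e5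
  · linear_combination e6
  · linear_combination e7
  · linear_combination e8

theorem modeSolution_trivial {m w : ℂ} (hw : w ^ 2 + w + 1 = 0) {r : G → ℂ}
    (m0 : m ≠ 0) (k1 : m - 1 ≠ 0) (k2 : m + 1 ≠ 0) (k3 : m - w ≠ 0) (k4 : m + w ≠ 0)
    (h : IsModeSolution (lineFn m 1 (-1) (-m * w ^ 2) (-m * w)) (lineFn 1 m (-m) (-w) (-w ^ 2))
      1 r) (z0 : r (0, 0) = 0) (z1 : r (0, 1) = 0) (z3 : r (1, 0) = 0) (s : G) : r s = 0 := by
  have e : ∀ d, _ := fun d => modeSolution_expand h (AddChar.one_apply _) (AddChar.one_apply _) d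
  have e1 := e (0, 1)
  have e2 := e (0, 2)
  have e3 := e (1, 0)
  have e4 := e (1, 1)
  have e5 := e (1, 2)
  have e6 := e (2, 0)
  have e7 := e (2, 1)
  have e8 := e (2, 2)
  simp only [Prod.mk_add_mk, zero_add, add_zero, zmod_one_add_one, zmod_one_add_two,
    zmod_two_add_one, zmod_two_add_two, lineFn_00, lineFn_01, lineFn_02, lineFn_10, lineFn_11,
    lineFn_12, lineFn_20, lineFn_21, lineFn_22, one_pow, mul_one] at e1 e2 e3 e4 e5 e6 e7 e8
  revert s
  rw [forall_G]
  refine eq_zero_of_trivial_character hw m0 k1 k2 k3 k4 z0 z1 z3 ?_ ?_ ?_ ?_ ?_ ?_ ?_ ?_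
  · linear_combination e1
  · linear_combination e2
  · linear_combination e3
  · linear_combination e4
  · linear_combination e5
  · linear_combination e6
  · linear_combination e7
  · linear_combination e8

/-! ### Arithmetic of `ω` and unimodular numbers -/

theorem om_eq : om = -1 / 2 + (Real.sqrt 3 : ℂ) / 2 * Complex.I := by
  have : om = Complex.exp (((Real.pi - Real.pi / 3 : ℝ) : ℂ) * Complex.I) := by
    rw [om]
    congr 1
    push_cast
    ring
  rw [this, Complex.exp_mul_I, ← Complex.ofReal_cos, ← Complex.ofReal_sin, Real.cos_pi_sub,
    Real.sin_pi_sub, Real.cos_pi_div_three, Real.sin_pi_div_three]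
  push_cast
  ring

theorem sqrt_three_sq : (Real.sqrt 3 : ℂ) ^ 2 = 3 := by
  rw [← Complex.ofReal_pow, Real.sq_sqrt (by norm_num)]
  norm_num

theorem om_quadratic : om ^ 2 + om + 1 = 0 := by
  rw [om_eq]
  linear_combination (1 / 4 * Complex.I ^ 2) * sqrt_three_sq + 3 / 4 * Complex.I_sq

theorem om_cube : om ^ 3 = 1 := by
  linear_combination (om - 1) * om_quadratic

theorem norm_om : ‖om‖ = 1 := by
  have : ‖om‖ ^ 3 = 1 := by rw [← norm_pow, om_cube, norm_one]
  exact (pow_eq_one_iff_of_nonneg (norm_nonneg _) (by norm_num)).1 this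

theorem conj_om : (starRingEnd ℂ) om = om ^ 2 := by
  have h1 : om * (starRingEnd ℂ) om = 1 := by
    rw [Complex.mul_conj, Complex.normSq_eq_norm_sq, norm_om]
    norm_num
  linear_combination om ^ 2 * h1 - (starRingEnd ℂ) om * om_cube

theorem conj_om_sq : (starRingEnd ℂ) (om ^ 2) = om := by
  rw [map_pow, conj_om]
  linear_combination om * om_cube

theorem mul_conj_of_norm {m : ℂ} (hm : ‖m‖ = 1) : m * (starRingEnd ℂ) m = 1 := by
  rw [Complex.mul_conj, Complex.normSq_eq_norm_sq, hm]
  norm_num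

/-- Dividing a root by `m ^ 2` and using `1 + 2ω = i√3` would give `Im (m ^ 2) = -3√3/2`, which is
below `-1`. -/
theorem quartic_ne_zero {m : ℂ} (hm : ‖m‖ = 1) :
    m ^ 4 + 3 * (1 + 2 * om) * m ^ 2 - 1 ≠ 0 := by
  intro h
  have hc := mul_conj_of_norm hm
  have h1 : m ^ 2 - (starRingEnd ℂ) (m ^ 2) + 3 * (1 + 2 * om) = 0 := by
    rw [map_pow]
    linear_combination (starRingEnd ℂ m) ^ 2 * h
      - (m ^ 2 + 3 * (1 + 2 * om)) * (m * starRingEnd ℂ m + 1) * hc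
  have h2 := congrArg Complex.im h1
  simp only [om_eq, Complex.add_im, Complex.sub_im, Complex.conj_im, Complex.mul_im,
    Complex.div_ofNat_im, Complex.div_ofNat_re] at h2
  norm_num at h2
  have h3 : |(m ^ 2).im| ≤ 1 := by
    refine (Complex.abs_im_le_norm _).trans ?_
    rw [norm_pow, hm]
    norm_num
  have h4 : (1 : ℝ) < Real.sqrt 3 := by
    rw [Real.lt_sqrt] <;> norm_num
  have h5 := (abs_le.1 h3).1
  linarith

/-! ### Reduction of nontrivial characters by automorphisms -/

/-- The automorphism `(k, l) ↦ (l, k)`. -/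
def autSwap : G ≃+ G := AddEquiv.prodComm

/-- The automorphism `(k, l) ↦ (l, 2k + l)`. -/
def autDiag : G ≃+ G where
  toFun s := (s.2, 2 * s.1 + s.2)
  invFun s := (2 * s.2 + s.1, s.1)
  left_inv := by decide
  right_inv := by decide
  map_add' := by decide

/-- The automorphism `(k, l) ↦ (2l, 2k + l)`. -/
def autAntidiag : G ≃+ G where
  toFun s := (2 * s.2, 2 * s.1 + s.2)
  invFun s := (2 * s.2 + 2 * s.1, 2 * s.1)
  left_inv := by decide
  right_inv := by decide
  map_add' := by decide

section Automorphisms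

variable {α : Type*} (a x y u w : α)

theorem lineFn_neg : lineFn a x y u w ∘ AddEquiv.neg G = lineFn a x y u w := by
  funext s
  revert s
  rw [forall_G]
  exact ⟨rfl, rfl, rfl, rfl, rfl, rfl, rfl, rfl, rfl⟩

theorem lineFn_autSwap : lineFn a x y u w ∘ autSwap = lineFn a y x u w := by
  funext s
  revert s
  rw [forall_G]
  exact ⟨rfl, rfl, rfl, rfl, rfl, rfl, rfl, rfl, rfl⟩

theorem lineFn_autDiag : lineFn a x y u w ∘ autDiag = lineFn a u x y w := by
  funext s
  revert s
  rw [forall_G]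
  exact ⟨rfl, rfl, rfl, rfl, rfl, rfl, rfl, rfl, rfl⟩

theorem lineFn_autAntidiag : lineFn a x y u w ∘ autAntidiag = lineFn a w x y u := by
  funext s
  revert s
  rw [forall_G]
  exact ⟨rfl, rfl, rfl, rfl, rfl, rfl, rfl, rfl, rfl⟩

end Automorphisms

theorem eq_one_or_om_or_om_sq {p : ℂ} (h : p ^ 3 = 1) : p = 1 ∨ p = om ∨ p = om ^ 2 := by
  have : (p - 1) * ((p - om) * (p - om ^ 2)) = 0 := by
    linear_combination h + (p - p ^ 2) * om_quadratic + (p - 1) * om_cube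
  simpa [sub_eq_zero] using this

theorem addChar_apply_cube (χ : AddChar G ℂ) (s : G) : χ s ^ 3 = 1 := by
  rw [← χ.map_nsmul_eq_pow]
  have : 3 • s = 0 := by
    revert s
    decide
  rw [this, χ.map_zero_eq_one]

theorem addChar_apply (χ : AddChar G ℂ) (k l : ZMod 3) : χ (k, l) = χ (k, 0) * χ (0, l) := by
  rw [← χ.map_add_eq_mul]
  simp

/-- Up to the sign, a nontrivial character of `G` is carried by one of four automorphisms to the
character `(k, l) ↦ ω ^ k`. -/
theorem exists_aut {χ : AddChar G ℂ} (hχ : χ ≠ 1) :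
    ∃ ψ ∈ ({AddEquiv.refl G, autSwap, autDiag, autAntidiag} : Set (G ≃+ G)),
      ∃ ν ∈ ({AddEquiv.refl G, AddEquiv.neg G} : Set (G ≃+ G)),
        χ (ψ (ν (1, 0))) = om ∧ χ (ψ (ν (0, 1))) = 1 := by
  have h20 := addChar_two_zero χ
  have h02 := addChar_zero_two χ
  have h11 := addChar_apply χ 1 1
  have h12 := addChar_apply χ 1 2
  have h21 := addChar_apply χ 2 1
  have h22 := addChar_apply χ 2 2
  have h4 : (om ^ 2) ^ 2 = om := by linear_combination om * om_cube
  have h5 : om ^ 2 * om = 1 := by rw [← om_cube]; ring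
  have h6 : om * om ^ 2 = 1 := by rw [← om_cube]; ring
  rcases eq_one_or_om_or_om_sq (addChar_apply_cube χ (1, 0)) with p | p | p <;>
  rcases eq_one_or_om_or_om_sq (addChar_apply_cube χ (0, 1)) with q | q | q <;>
  rw [p] at h20 <;> rw [q] at h02 <;>
  (try simp only [h4, one_pow] at h20) <;> (try simp only [h4, one_pow] at h02) <;>
  simp only [p, q, h20, h02, h5, h6, one_mul, mul_one] at h11 h12 h21 h22
  · refine absurd ?_ hχ
    ext s
    revert s
    rw [forall_G]
    exact ⟨χ.map_zero_eq_one, q, h02, p, h11, h12, h20, h21, h22⟩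
  · exact ⟨autSwap, by simp, AddEquiv.refl G, by simp, q, p⟩
  · exact ⟨autSwap, by simp, AddEquiv.neg G, by simp, h02, h20⟩
  · exact ⟨AddEquiv.refl G, by simp, AddEquiv.refl G, by simp, p, q⟩
  · exact ⟨autAntidiag, by simp, AddEquiv.neg G, by simp, q, h12⟩
  · exact ⟨autDiag, by simp, AddEquiv.refl G, by simp, h02, h11⟩
  · exact ⟨AddEquiv.refl G, by simp, AddEquiv.neg G, by simp, h20, h02⟩
  · exact ⟨autDiag, by simp, AddEquiv.neg G, by simp, q, h22⟩
  · exact ⟨autAntidiag, by simp, AddEquiv.refl G, by simp, h02, h21⟩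

/-- The generating function of `matA μ` as a group matrix of `G`. -/
noncomputable def genFn (m : ℂ) : G → ℂ := lineFn 1 m (-m) (-om) (-om ^ 2)

theorem mul_genFn_conj {m : ℂ} (hc : m * starRingEnd ℂ m = 1) :
    (fun s => m * starRingEnd ℂ (genFn m s)) = lineFn m 1 (-1) (-m * om ^ 2) (-m * om) := by
  funext s
  rw [genFn, comp_lineFn (F := starRingEnd ℂ), comp_lineFn (F := fun z => m * z)]
  simp only [map_one, map_neg, conj_om, conj_om_sq, mul_one, mul_neg, hc, neg_mul]

theorem ne_of_pow_twelve {m c : ℂ} (h : m ^ 12 ≠ 1) (hc : c ^ 12 = 1) : m - c ≠ 0 := by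
  intro h0
  rw [sub_eq_zero.1 h0] at h
  exact h hc

theorem ne_neg_of_pow_twelve {m c : ℂ} (h : m ^ 12 ≠ 1) (hc : c ^ 12 = 1) : m + c ≠ 0 := by
  rw [← sub_neg_eq_add]
  exact ne_of_pow_twelve h (by rw [Even.neg_pow (by decide), hc])

theorem om_pow_twelve : om ^ 12 = 1 := by
  rw [show om ^ 12 = (om ^ 3) ^ 4 by ring, om_cube, one_pow]

theorem om_sq_pow_twelve : (om ^ 2) ^ 12 = 1 := by
  rw [show (om ^ 2) ^ 12 = (om ^ 3) ^ 8 by ring, om_cube, one_pow]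

theorem modeSolution_param {m : ℂ} (hm : ‖m‖ = 1) (h12 : m ^ 12 ≠ 1) {χ : AddChar G ℂ}
    (h10 : χ (1, 0) = om) (h01 : χ (0, 1) = 1) {r : G → ℂ}
    (h : IsModeSolution (fun s => starRingEnd ℂ (genFn m s)) (genFn m) χ r) :
    ∃ A B, ∀ s, r s = A + B * χ s := by
  have hc := mul_conj_of_norm hm
  have m0 : m ≠ 0 := by rintro rfl; simp at hm
  refine modeSolution_line_param om_quadratic h10 h01 m0 (ne_of_pow_twelve h12 (one_pow _))
    (ne_neg_of_pow_twelve h12 (one_pow _)) (ne_of_pow_twelve h12 om_pow_twelve)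
    (ne_neg_of_pow_twelve h12 om_pow_twelve) (ne_of_pow_twelve h12 om_sq_pow_twelve)
    (ne_neg_of_pow_twelve h12 om_sq_pow_twelve) ?_
  rw [← mul_genFn_conj hc]
  exact h.smul m

theorem modeSolution_omega {m : ℂ} (hm : ‖m‖ = 1) (h12 : m ^ 12 ≠ 1) {χ : AddChar G ℂ}
    (h10 : χ (1, 0) = om) (h01 : χ (0, 1) = 1) {r : G → ℂ}
    (h : IsModeSolution (fun s => starRingEnd ℂ (lineFn 1 (-om) m (-m) (-om ^ 2) s))
      (lineFn 1 (-om) m (-m) (-om ^ 2)) χ r) :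
    ∃ A B, ∀ s, r s = A + B * χ s := by
  have hc := mul_conj_of_norm hm
  have m0 : m ≠ 0 := by rintro rfl; simp at hm
  have k7 : m ^ 2 + 1 ≠ 0 := by
    intro h0
    apply h12
    linear_combination (m ^ 10 - m ^ 8 + m ^ 6 - m ^ 4 + m ^ 2 - 1) * h0
  refine modeSolution_line_omega om_quadratic h10 h01 m0
    (ne_of_pow_twelve h12 om_pow_twelve) (ne_neg_of_pow_twelve h12 om_pow_twelve)
    (ne_of_pow_twelve h12 om_sq_pow_twelve) (ne_neg_of_pow_twelve h12 om_sq_pow_twelve)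
    k7 (quartic_ne_zero hm) ?_
  convert h.smul m using 1
  funext s
  rw [comp_lineFn (F := starRingEnd ℂ), comp_lineFn (F := fun z => m * z)]
  simp only [map_one, map_neg, conj_om, conj_om_sq, mul_one, mul_neg, hc, neg_mul]

/-- An automorphism carries the kernel of `χ` to `{0} × ℤ/3`, and negation, under which the
generating function is invariant, replaces `ω²` by `ω`. What remains is the entry on the kernel
line: `±m` falls under `modeSolution_param`, while `-ω` and `-ω²` fall under `modeSolution_omega`.
-/
theorem modeSolution_nontrivial {m : ℂ} (hm : ‖m‖ = 1) (h12 : m ^ 12 ≠ 1) {χ : AddChar G ℂ}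
    (hχ : χ ≠ 1) {r : G → ℂ}
    (h : IsModeSolution (fun s => starRingEnd ℂ (genFn m s)) (genFn m) χ r) :
    ∃ A B, ∀ s, r s = A + B * χ s := by
  obtain ⟨ψ, hψ, ν, hν, h10, h01⟩ := exists_aut hχ
  have hν' : ∀ a x y u w : ℂ, lineFn a x y u w ∘ ν = lineFn a x y u w := by
    intro a x y u w
    rcases hν with rfl | rfl
    · rfl
    · exact lineFn_neg a x y u w
  have hcomp := (h.comp ψ).comp ν
  have key : ∃ A B, ∀ s, (r ∘ ψ ∘ ν) s = A + B *
      (χ.compAddMonoidHom ψ.toAddMonoidHom).compAddMonoidHom ν.toAddMonoidHom s := by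
    have hg : ((fun s => starRingEnd ℂ (genFn m s)) ∘ ψ) ∘ ν =
      fun s => starRingEnd ℂ (((genFn m ∘ ψ) ∘ ν) s) := rfl
    rw [hg] at hcomp
    have hm' : ‖-m‖ = 1 := by rwa [norm_neg]
    have h12' : (-m) ^ 12 ≠ 1 := by rwa [Even.neg_pow (by decide)]
    rcases hψ with rfl | rfl | rfl | rfl
    · refine modeSolution_param hm h12 h10 h01 (?_ : IsModeSolution _ _ _ _)
      have : (genFn m ∘ AddEquiv.refl G) ∘ ν = genFn m := hν' _ _ _ _ _
      rwa [this] at hcomp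
    · refine modeSolution_param hm' h12' h10 h01 (?_ : IsModeSolution _ _ _ _)
      have : (genFn m ∘ autSwap) ∘ ν = genFn (-m) := by
        rw [genFn, lineFn_autSwap, hν', genFn, neg_neg]
      rwa [this] at hcomp
    · refine modeSolution_omega hm h12 h10 h01 (?_ : IsModeSolution _ _ _ _)
      have : (genFn m ∘ autDiag) ∘ ν = lineFn 1 (-om) m (-m) (-om ^ 2) := by
        rw [genFn, lineFn_autDiag, hν']
      rwa [this] at hcomp
    -- The kernel line carries `-ω²`. Conjugation turns this into the `-ω` case with parameter `conj
    -- m`, and `swap` exchanges the function with its conjugate.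
    · refine modeSolution_omega (m := starRingEnd ℂ m) (by rwa [RCLike.norm_conj]) ?_ h10 h01
        (?_ : IsModeSolution _ _ _ _)
      · rw [← map_pow]
        intro h0
        apply h12
        simpa using congrArg (starRingEnd ℂ) h0
      have : (genFn m ∘ autAntidiag) ∘ ν = lineFn 1 (-om ^ 2) m (-m) (-om) := by
        rw [genFn, lineFn_autAntidiag, hν']
      rw [this] at hcomp
      have h1 : (fun s => starRingEnd ℂ (lineFn 1 (-om ^ 2) m (-m) (-om) s)) =
          lineFn 1 (-om) (starRingEnd ℂ m) (-starRingEnd ℂ m) (-om ^ 2) := by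
        funext s
        rw [comp_lineFn (F := starRingEnd ℂ)]
        simp only [map_one, map_neg, conj_om, conj_om_sq]
      have h2 : (fun s => starRingEnd ℂ
          (lineFn 1 (-om) (starRingEnd ℂ m) (-starRingEnd ℂ m) (-om ^ 2) s)) =
          lineFn 1 (-om ^ 2) m (-m) (-om) := by
        rw [← h1]
        funext s
        simp
      rw [h2, ← h1]
      exact hcomp.swap
  obtain ⟨A, B, hAB⟩ := key
  refine ⟨A, B, fun s => ?_⟩
  have := hAB (ν.symm (ψ.symm s))
  simpa using this

/-! ### Fourier decomposition of the kernel and the upper bound 19 -/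

/-- The identification of the index set of `9 × 9` matrices with `G`. -/
def idx : Fin 9 ≃ G := (finProdFinEquiv (m := 3) (n := 3)).symm

theorem basicForm_apply (x y u w : ℂ) (i j : Fin 9) :
    basicForm x y u w i j = lineFn 1 x y u w (idx j - idx i) := by
  fin_cases i <;> fin_cases j <;> rfl

theorem matA_apply (m : ℂ) (i j : Fin 9) : matA m i j = genFn m (idx j - idx i) :=
  basicForm_apply _ _ _ _ i j

theorem sum_idx_sub {M : Type*} [AddCommMonoid M] (Φ : G → G → M) (i j : Fin 9) :
    ∑ k, Φ (idx i - idx k) (idx j - idx k) = ∑ s, Φ s (s + (idx j - idx i)) := by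
  rw [← Equiv.sum_comp (idx.trans (Equiv.subLeft (idx i))) (fun s => Φ s (s + (idx j - idx i)))]
  refine Finset.sum_congr rfl fun k _ => ?_
  simp only [Equiv.trans_apply, Equiv.subLeft_apply]
  congr 1
  abel

/-- The Fourier coefficient of `R` at `χ`, along the diagonals with fixed index difference. -/
noncomputable def modeCoeff (R : Matrix (Fin 9) (Fin 9) ℝ) (χ : AddChar G ℂ) (s : G) : ℂ :=
  ∑ k, χ (-k) * (R (idx.symm k) (idx.symm (k + s)) : ℂ)

/-- Fourier inversion on `G` along the diagonal with difference `s`. -/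
theorem eq_zero_of_modeCoeff {R : Matrix (Fin 9) (Fin 9) ℝ} {s : G}
    (h : ∀ χ, modeCoeff R χ s = 0) (j : G) : R (idx.symm j) (idx.symm (j + s)) = 0 := by
  have h1 : ∑ χ : AddChar G ℂ, χ j * modeCoeff R χ s = 0 := by simp [h]
  simp only [modeCoeff, Finset.mul_sum] at h1
  rw [Finset.sum_comm] at h1
  have h2 : ∀ k : G, ∑ χ : AddChar G ℂ,
      χ j * (χ (-k) * (R (idx.symm k) (idx.symm (k + s)) : ℂ)) =
      if k = j then 9 * (R (idx.symm k) (idx.symm (k + s)) : ℂ) else 0 := by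
    intro k
    have h3 := AddChar.sum_apply_eq_ite (j - k)
    simp only [← mul_assoc, ← Finset.sum_mul, ← AddChar.map_add_eq_mul, ← sub_eq_add_neg, h3,
      sub_eq_zero, eq_comm (a := j), Fintype.card_prod, ZMod.card]
    split_ifs <;> norm_num
  simp only [h2, Finset.sum_ite_eq', Finset.mem_univ, if_true] at h1
  simpa using h1

theorem unitarityDeriv_basicForm_apply (x y u w : ℂ) (R : Matrix (Fin 9) (Fin 9) ℝ)
    (i j : Fin 9) :
    unitarityDeriv (basicForm x y u w) R i j = Complex.I * ∑ k,
      starRingEnd ℂ (lineFn 1 x y u w (idx i - idx k)) * lineFn 1 x y u w (idx j - idx k) *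
        ((R k j : ℂ) - R k i) := by
  simp only [unitarityDeriv, LinearMap.coe_mk, AddHom.coe_mk, Matrix.of_apply, basicForm_apply,
    Finset.mul_sum]
  refine Finset.sum_congr rfl fun k _ => ?_
  push_cast
  rw [Complex.star_def]
  ring

theorem isModeSolution_of_mem_ker {m : ℂ} {R : Matrix (Fin 9) (Fin 9) ℝ}
    (h : unitarityDeriv (matA m) R = 0) (χ : AddChar G ℂ) :
    IsModeSolution (fun s => starRingEnd ℂ (genFn m s)) (genFn m) χ (modeCoeff R χ) := by
  intro d
  have h0 : ∀ i : G, ∑ s, starRingEnd ℂ (genFn m s) * genFn m (s + d) *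
      ((R (idx.symm (i - s)) (idx.symm (i + d)) : ℂ) - R (idx.symm (i - s)) (idx.symm i)) = 0 := by
    intro i
    have h1 := congrFun (congrFun h (idx.symm i)) (idx.symm (i + d))
    rw [matA, unitarityDeriv_basicForm_apply] at h1
    simp only [Matrix.zero_apply, mul_eq_zero, Complex.I_ne_zero, false_or,
      Equiv.apply_symm_apply] at h1
    rw [← h1, ← Equiv.sum_comp (idx.trans (Equiv.subLeft i))]
    refine Finset.sum_congr rfl fun k _ => ?_
    simp only [Equiv.trans_apply, Equiv.subLeft_apply, sub_sub_cancel, Equiv.symm_apply_apply,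
      genFn]
    rw [show i - idx k + d = i + d - idx k by abel]
  -- Fourier transform of the equations for the entries `(i, i + d)`; the shift `i = k + s` then
  -- produces the factor `χ (-s)`.
  have h1 : ∑ i : G, χ (-i) * ∑ s, starRingEnd ℂ (genFn m s) * genFn m (s + d) *
      ((R (idx.symm (i - s)) (idx.symm (i + d)) : ℂ) - R (idx.symm (i - s)) (idx.symm i)) = 0 := by
    simp [h0]
  rw [← h1]
  simp only [Finset.mul_sum]
  rw [Finset.sum_comm]
  refine Finset.sum_congr rfl fun s _ => ?_
  rw [← Equiv.sum_comp (Equiv.addRight s)]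
  simp only [modeCoeff, ← Finset.sum_sub_distrib, Finset.mul_sum, Finset.sum_mul,
    Equiv.coe_addRight, add_sub_cancel_right, neg_add, AddChar.map_add_eq_mul]
  refine Finset.sum_congr rfl fun k _ => ?_
  rw [add_assoc k s d]
  ring

/-- Nineteen linear functionals that separate the points of the kernel for generic `μ`. -/
def separating : Matrix (Fin 9) (Fin 9) ℝ →ₗ[ℝ] (G → ℝ) × (Fin 7 → ℝ) × (ZMod 3 → ℝ) where
  toFun R := (fun k => R (idx.symm k) (idx.symm k),
    fun n => R (idx.symm (![(0, 0), (0, 1), (0, 2), (1, 1), (1, 2), (2, 1), (2, 2)] n))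
      (idx.symm (![(0, 0), (0, 1), (0, 2), (1, 1), (1, 2), (2, 1), (2, 2)] n + (0, 1))),
    fun a => ∑ l, R (idx.symm (a, l)) (idx.symm (a + 1, l)))
  map_add' R S := by
    ext <;> simp [Finset.sum_add_distrib]
  map_smul' c R := by
    ext <;> simp [Finset.mul_sum]

theorem eq_zero_of_om_sq_mul_add {b₁ b₂ : ℝ} (h : om ^ 2 * b₁ + om * b₂ = 0) :
    b₁ = 0 ∧ b₂ = 0 := by
  have h1 : om * b₁ + b₂ = 0 := by
    linear_combination om ^ 2 * h - (om * b₁ + b₂) * om_cube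
  have h2 := congrArg Complex.im h1
  have h3 := congrArg Complex.re h1
  have h4 : Real.sqrt 3 ≠ 0 := by positivity
  simp [om_eq] at h2 h3
  subst h2
  simpa using h3

/-- A mode in the span of `1` and `χ` vanishes once it vanishes at two points where `χ` differs: `0`
and `(1, 0)` if `χ (0, 1) = 1`, and `0` and `(0, 1)` otherwise. The trivial mode needs all three
points. The coefficient at `(1, 0)` is needed only for characters trivial on `{0} × ℤ/3`, hence the
three coset sums. -/
theorem separating_injective {m : ℂ} (hm : ‖m‖ = 1) (h12 : m ^ 12 ≠ 1)
    {R : Matrix (Fin 9) (Fin 9) ℝ} (h : unitarityDeriv (matA m) R = 0)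
    (hs : separating R = 0) : R = 0 := by
  have hsol := isModeSolution_of_mem_ker h
  simp only [separating, LinearMap.coe_mk, AddHom.coe_mk, Prod.mk_eq_zero, funext_iff,
    Pi.zero_apply] at hs
  obtain ⟨hd, h7, hS⟩ := hs
  have c00 : ∀ χ, modeCoeff R χ 0 = 0 := fun χ => by
    simp [modeCoeff, hd]
  have c10 : ∀ χ : AddChar G ℂ, χ (0, 1) = 1 → modeCoeff R χ (1, 0) = 0 := by
    intro χ h01
    rw [modeCoeff, Fintype.sum_prod_type]
    refine Finset.sum_eq_zero fun a _ => ?_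
    have : ∀ l, χ (-(a, l)) = χ (-a, 0) := fun l => addChar_snd_trivial h01 _ _
    simp only [this, ← Finset.mul_sum, Prod.mk_add_mk, add_zero]
    rw [← Complex.ofReal_sum, hS a, Complex.ofReal_zero, mul_zero]
  have nontriv : ∀ χ : AddChar G ℂ, χ ≠ 1 → χ (0, 1) = 1 → ∀ s, modeCoeff R χ s = 0 := by
    intro χ hχ h01
    obtain ⟨A, B, hAB⟩ := modeSolution_nontrivial hm h12 hχ (hsol χ)
    have e0 := hAB 0
    have e1 := hAB (1, 0)
    rw [c00, χ.map_zero_eq_one] at e0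
    rw [c10 χ h01] at e1
    have hne : χ (1, 0) - 1 ≠ 0 := by
      intro h0
      apply hχ
      rw [sub_eq_zero] at h0
      have h20 := addChar_two_zero χ
      rw [h0, one_pow] at h20
      ext ⟨k, l⟩
      rw [addChar_snd_trivial h01, AddChar.one_apply]
      fin_cases k
      · exact χ.map_zero_eq_one
      · exact h0
      · exact h20
    have hB : B = 0 := by
      have : B * (χ (1, 0) - 1) = 0 := by linear_combination e0 - e1
      simpa [hne] using this
    have hA : A = 0 := by rw [hB] at e0; linear_combination -e0
    intro s
    rw [hAB, hA, hB]
    ring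
  -- The character `ω ^ k` is already known to have a vanishing coefficient at `(0, 1)`. This
  -- complex relation is worth two real ones, so seven of the nine entries determine the other two.
  have off : ∀ k, R (idx.symm k) (idx.symm (k + (0, 1))) = 0 := by
    let χ : AddChar G ℂ :=
      (AddChar.zmodChar 3 om_cube).compAddMonoidHom (AddMonoidHom.fst (ZMod 3) (ZMod 3))
    have v1 : χ (1, 0) = om := by
      change om ^ 1 = om
      rw [pow_one]
    have v2 : χ (2, 0) = om ^ 2 := rfl
    have v01 : χ (0, 1) = 1 := rfl
    have hχ : χ ≠ 1 := by
      intro h0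
      rw [h0, AddChar.one_apply] at v1
      have := om_quadratic
      rw [← v1] at this
      norm_num at this
    have hc := nontriv χ hχ v01 (0, 1)
    have p0 := h7 0
    have p1 := h7 1
    have p2 := h7 2
    have p3 := h7 3
    have p4 := h7 4
    have p5 := h7 5
    have p6 := h7 6
    simp only [Matrix.cons_val] at p0 p1 p2 p3 p4 p5 p6
    rw [modeCoeff, sum_G] at hc
    simp only [p0, p1, p2, p3, p4, p5, p6, Complex.ofReal_zero, mul_zero, zero_add,
      add_zero, Prod.neg_mk, neg_zero, zmod_neg_one, zmod_neg_two, v1, v2] at hc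
    obtain ⟨q1, q2⟩ := eq_zero_of_om_sq_mul_add hc
    rw [forall_G]
    exact ⟨p0, p1, p2, q1, p3, p4, q2, p5, p6⟩
  have c01 : ∀ χ, modeCoeff R χ (0, 1) = 0 := fun χ => by
    simp [modeCoeff, off]
  have all : ∀ χ s, modeCoeff R χ s = 0 := by
    intro χ
    by_cases hχ : χ = 1
    · have h0 := hsol χ
      rw [hχ] at h0 ⊢
      have hc := mul_conj_of_norm hm
      have m0 : m ≠ 0 := by rintro rfl; simp at hm
      refine modeSolution_trivial om_quadratic m0 (ne_of_pow_twelve h12 (one_pow _))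
        (ne_neg_of_pow_twelve h12 (one_pow _)) (ne_of_pow_twelve h12 om_pow_twelve)
        (ne_neg_of_pow_twelve h12 om_pow_twelve) ?_ (c00 1) (c01 1) (c10 1 rfl)
      rw [← mul_genFn_conj hc]
      exact h0.smul m
    by_cases h01 : χ (0, 1) = 1
    · exact nontriv χ hχ h01
    obtain ⟨A, B, hAB⟩ := modeSolution_nontrivial hm h12 hχ (hsol χ)
    have e0 := hAB 0
    have e1 := hAB (0, 1)
    rw [c00, χ.map_zero_eq_one] at e0
    rw [c01 χ] at e1
    have hne : χ (0, 1) - 1 ≠ 0 := sub_ne_zero.2 h01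
    have hB : B = 0 := by
      have : B * (χ (0, 1) - 1) = 0 := by linear_combination e0 - e1
      simpa [hne] using this
    have hA : A = 0 := by rw [hB] at e0; linear_combination -e0
    intro s
    rw [hAB, hA, hB]
    ring
  ext i j
  have := eq_zero_of_modeCoeff (fun χ => all χ (idx j - idx i)) (idx i)
  simpa using this

theorem finrank_ker_le {m : ℂ} (hm : ‖m‖ = 1) (h12 : m ^ 12 ≠ 1) :
    Module.finrank ℝ (LinearMap.ker (unitarityDeriv (matA m))) ≤ 19 := by
  have hinj : Function.Injective
      (separating.domRestrict (LinearMap.ker (unitarityDeriv (matA m)))) := by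
    rw [← LinearMap.ker_eq_bot, LinearMap.ker_eq_bot']
    rintro ⟨R, hR⟩ h0
    exact Subtype.ext (separating_injective hm h12 (LinearMap.mem_ker.1 hR) h0)
  refine (LinearMap.finrank_le_finrank_of_injective hinj).trans ?_
  -- The target has dimension `9 + 7 + 3`.
  simp [Module.finrank_prod, ZMod.card]

/-! ### The Hadamard property and the lower bound 19 -/

section Correlation

variable {x y u w : ℂ}

theorem conj_sum_eq_one (h : x + y + u + w = 1) :
    starRingEnd ℂ x + starRingEnd ℂ y + starRingEnd ℂ u + starRingEnd ℂ w = 1 := by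
  rw [← map_add, ← map_add, ← map_add, h, map_one]

/-- All Fourier coefficients of the line function have modulus 3: the trivial one is `1 + 2 = 3`,
and at a character whose kernel line carries `z` it is `1 + 2z - (1 - z) = 3z`. The proof checks the
equivalent nine correlations directly. -/
theorem autocorrelation (hx : ‖x‖ = 1) (hy : ‖y‖ = 1) (hu : ‖u‖ = 1) (hw : ‖w‖ = 1)
    (h : x + y + u + w = 1) (d : G) :
    ∑ s, starRingEnd ℂ (lineFn 1 x y u w s) * lineFn 1 x y u w (s + d) =
      if d = 0 then 9 else 0 := by
  have hc := conj_sum_eq_one h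
  have hx := mul_conj_of_norm hx
  have hy := mul_conj_of_norm hy
  have hu := mul_conj_of_norm hu
  have hw := mul_conj_of_norm hw
  simp only [comp_lineFn (F := starRingEnd ℂ), map_one, sum_G]
  generalize starRingEnd ℂ x = X at *
  generalize starRingEnd ℂ y = Y at *
  generalize starRingEnd ℂ u = U at *
  generalize starRingEnd ℂ w = W at *
  revert d
  rw [forall_G]
  simp only [Prod.mk_add_mk, zero_add, add_zero, zmod_one_add_one, zmod_one_add_two,
    zmod_two_add_one, zmod_two_add_two, lineFn_00, lineFn_01, lineFn_02, lineFn_10, lineFn_11,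
    lineFn_12, lineFn_20, lineFn_21, lineFn_22]
  refine ⟨?_, ?_, ?_, ?_, ?_, ?_, ?_, ?_, ?_⟩
  · rw [if_pos (show ((0, 0) : G) = 0 from rfl)]
    linear_combination 2 * hx + 2 * hy + 2 * hu + 2 * hw
  all_goals rw [if_neg (by decide)]
  · linear_combination 2 * hx - hy - hu - hw + (Y + U + W) * h + (1 - x) * hc
  · linear_combination 2 * hx - hy - hu - hw + (Y + U + W) * h + (1 - x) * hc
  · linear_combination 2 * hy - hx - hu - hw + (X + U + W) * h + (1 - y) * hc
  · linear_combination 2 * hu - hx - hy - hw + (X + Y + W) * h + (1 - u) * hc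
  · linear_combination 2 * hw - hx - hy - hu + (X + Y + U) * h + (1 - w) * hc
  · linear_combination 2 * hy - hx - hu - hw + (X + U + W) * h + (1 - y) * hc
  · linear_combination 2 * hw - hx - hy - hu + (X + Y + U) * h + (1 - w) * hc
  · linear_combination 2 * hu - hx - hy - hw + (X + Y + W) * h + (1 - u) * hc

theorem isHadamard_basicForm (hx : ‖x‖ = 1) (hy : ‖y‖ = 1) (hu : ‖u‖ = 1) (hw : ‖w‖ = 1)
    (h : x + y + u + w = 1) : IsHadamard (basicForm x y u w) := by
  refine ⟨fun i j => ?_, ?_⟩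
  · rw [basicForm_apply, comp_lineFn (F := fun z : ℂ => ‖z‖), norm_one, hx, hy, hu, hw]
    simp [lineFn]
  · ext i j
    simp only [Matrix.mul_apply, Matrix.conjTranspose_apply, basicForm_apply]
    rw [sum_idx_sub (fun s t => star (lineFn 1 x y u w s) * lineFn 1 x y u w t)]
    simp only [Complex.star_def]
    rw [autocorrelation hx hy hu hw h]
    rcases eq_or_ne i j with rfl | hij
    · simp
    · have : idx j - idx i ≠ 0 := by
        rw [sub_ne_zero]
        exact fun he => hij (idx.injective he).symm
      simp [this, hij]

/-- The derivative of the vanishing autocorrelation in a phase direction `(a, b, c, e)` that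
preserves `x + y + u + w = 1` to first order. -/
theorem sum_conj_mul_lineFn_sub {a b c e : ℝ} (h : x + y + u + w = 1)
    (hp : x * a + y * b + u * c + w * e = 0) (d : G) :
    ∑ s, starRingEnd ℂ (lineFn 1 x y u w s) * lineFn 1 x y u w (s + d) *
      (((lineFn 0 a b c e (s + d) : ℝ) : ℂ) - (lineFn 0 a b c e s : ℝ)) = 0 := by
  have hc := conj_sum_eq_one h
  have hq := congrArg (starRingEnd ℂ) hp
  simp only [map_add, map_mul, Complex.conj_ofReal, map_zero] at hq
  simp only [comp_lineFn (F := starRingEnd ℂ), comp_lineFn (F := ((↑) : ℝ → ℂ)), map_one, sum_G,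
    Complex.ofReal_zero]
  generalize starRingEnd ℂ x = X at *
  generalize starRingEnd ℂ y = Y at *
  generalize starRingEnd ℂ u = U at *
  generalize starRingEnd ℂ w = W at *
  revert d
  rw [forall_G]
  simp only [Prod.mk_add_mk, zero_add, add_zero, zmod_one_add_one, zmod_one_add_two,
    zmod_two_add_one, zmod_two_add_two, lineFn_00, lineFn_01, lineFn_02, lineFn_10, lineFn_11,
    lineFn_12, lineFn_20, lineFn_21, lineFn_22]
  refine ⟨?_, ?_, ?_, ?_, ?_, ?_, ?_, ?_, ?_⟩
  · ring
  · linear_combination (Y + U + W) * hp - (y + u + w) * hq - x * a * hc + X * a * h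
  · linear_combination (Y + U + W) * hp - (y + u + w) * hq - x * a * hc + X * a * h
  · linear_combination (X + U + W) * hp - (x + u + w) * hq - y * b * hc + Y * b * h
  · linear_combination (X + Y + W) * hp - (x + y + w) * hq - u * c * hc + U * c * h
  · linear_combination (X + Y + U) * hp - (x + y + u) * hq - w * e * hc + W * e * h
  · linear_combination (X + U + W) * hp - (x + u + w) * hq - y * b * hc + Y * b * h
  · linear_combination (X + Y + U) * hp - (x + y + u) * hq - w * e * hc + W * e * h
  · linear_combination (X + Y + W) * hp - (x + y + w) * hq - u * c * hc + U * c * h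

end Correlation

/-- The tangent vector to the block circulant family with phase velocities `a, b, c, e`. -/
def pattern (a b c e : ℝ) : Matrix (Fin 9) (Fin 9) ℝ :=
  Matrix.of fun i j => lineFn 0 a b c e (idx j - idx i)

theorem pattern_mem_ker {x y u w : ℂ} {a b c e : ℝ} (h : x + y + u + w = 1)
    (hp : x * a + y * b + u * c + w * e = 0) :
    unitarityDeriv (basicForm x y u w) (pattern a b c e) = 0 := by
  ext i j
  rw [unitarityDeriv_basicForm_apply]
  simp only [pattern, Matrix.of_apply]
  rw [sum_idx_sub (fun s t => starRingEnd ℂ (lineFn 1 x y u w s) * lineFn 1 x y u w t *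
    (((lineFn 0 a b c e t : ℝ) : ℂ) - (lineFn 0 a b c e s : ℝ)))]
  rw [sum_conj_mul_lineFn_sub h hp, mul_zero, Matrix.zero_apply]

theorem add_mem_ker {n : ℕ} {H : Matrix (Fin n) (Fin n) ℂ} (hH : IsHadamard H)
    (α β : Fin n → ℝ) : unitarityDeriv H (Matrix.of fun i j => α i + β j) = 0 := by
  ext i j
  have h := congrFun (congrFun hH.2 i) j
  simp only [Matrix.mul_apply, Matrix.conjTranspose_apply, Matrix.smul_apply, Matrix.one_apply,
    smul_eq_mul] at h
  simp only [unitarityDeriv, LinearMap.coe_mk, AddHom.coe_mk, Matrix.of_apply,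
    add_sub_add_left_eq_sub, ← Finset.sum_mul, h, Matrix.zero_apply]
  split_ifs with hij
  · simp [hij]
  · simp

/-- Three vectors in the real plane are linearly dependent. Since `m ≠ 0`, the coefficients of `ω`
and `ω²` cannot both vanish, so this direction is independent of the rotation of `μ`. -/
theorem exists_tangent {m : ℂ} (hm : ‖m‖ = 1) : ∃ κ γ δ : ℝ, (γ ≠ 0 ∨ δ ≠ 0) ∧
    m * (κ : ℂ) - om * γ - om ^ 2 * δ = 0 := by
  have hc := mul_conj_of_norm hm
  set M := starRingEnd ℂ m
  -- After multiplication by `M = conj m` the relation reads `κ = ωMγ + ω²Mδ`: `γ, δ` cancel the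
  -- imaginary part, and `κ` is the real part.
  refine ⟨((om ^ 2 * M).im * (om * M).re - (om * M).im * (om ^ 2 * M).re), (om ^ 2 * M).im,
    -(om * M).im, ?_, ?_⟩
  · by_contra h0
    push Not at h0
    obtain ⟨h1, h2⟩ := h0
    have h3 : (om ^ 2 * M + om * M + M).im = 0 := by
      rw [← add_mul, ← one_mul M, ← mul_assoc, ← add_mul]
      simp [om_quadratic]
    have h4 : M.im = 0 := by
      simp only [Complex.add_im] at h3
      linarith
    have h5 : M.re ≠ 0 := by
      intro h5
      have : M = 0 := Complex.ext h5 h4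
      simp [this] at hc
    have h6 : om.im * M.re = 0 := by
      rw [Complex.mul_im, h4] at h2
      linarith
    have h7 : om.im ≠ 0 := by
      simp [om_eq]
    exact (mul_ne_zero h7 h5) h6
  · have e : ((((om ^ 2 * M).im * (om * M).re - (om * M).im * (om ^ 2 * M).re : ℝ)) : ℂ) =
        om * M * ((om ^ 2 * M).im : ℝ) + om ^ 2 * M * ((-(om * M).im : ℝ) : ℂ) := by
      apply Complex.ext <;> simp only [Complex.ofReal_re, Complex.ofReal_im, Complex.add_re,
        Complex.add_im, Complex.mul_re (om * M), Complex.mul_im (om * M),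
        Complex.mul_re (om ^ 2 * M), Complex.mul_im (om ^ 2 * M)] <;> ring
    rw [e]
    linear_combination (om * ((om ^ 2 * M).im : ℝ) + om ^ 2 * ((-(om * M).im : ℝ) : ℂ)) * hc

theorem matA_sum (m : ℂ) : m + -m + -om + -om ^ 2 = 1 := by
  linear_combination -om_quadratic

theorem norm_om_sq : ‖-om ^ 2‖ = 1 := by
  rw [norm_neg, norm_pow, norm_om, one_pow]

theorem isHadamard_matA {m : ℂ} (hm : ‖m‖ = 1) : IsHadamard (matA m) :=
  isHadamard_basicForm hm (by rwa [norm_neg]) (by rw [norm_neg, norm_om]) norm_om_sq (matA_sum m)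

/-- Row phases, column phases and a two-dimensional space of block circulant directions. -/
def tangentMap (κ γ δ : ℝ) :
    (Fin 9 → ℝ) × (Fin 8 → ℝ) × (Fin 2 → ℝ) →ₗ[ℝ] Matrix (Fin 9) (Fin 9) ℝ where
  toFun v := (Matrix.of fun i j => v.1 i + (Fin.cons 0 v.2.1 : Fin 9 → ℝ) j) +
    pattern (v.2.2 0 + v.2.2 1 * κ) (v.2.2 0) (v.2.2 1 * γ) (v.2.2 1 * δ)
  map_add' v v' := by
    ext i j
    simp only [pattern, lineFn, Matrix.add_apply, Matrix.of_apply, Prod.fst_add, Prod.snd_add,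
      Pi.add_apply]
    refine Fin.cases ?_ (fun j => ?_) j <;> simp only [Fin.cons_zero, Fin.cons_succ, Pi.add_apply]
      <;> split_ifs <;> ring
  map_smul' c v := by
    ext i j
    simp only [pattern, lineFn, Matrix.add_apply, Matrix.of_apply, Prod.smul_fst, Prod.smul_snd,
      Pi.smul_apply, Matrix.smul_apply, smul_eq_mul, RingHom.id_apply]
    refine Fin.cases ?_ (fun j => ?_) j <;> simp only [Fin.cons_zero, Fin.cons_succ,
      Pi.smul_apply, smul_eq_mul] <;> split_ifs <;> ring

theorem tangentMap_injective {κ γ δ : ℝ} (h : γ ≠ 0 ∨ δ ≠ 0) :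
    Function.Injective (tangentMap κ γ δ) := by
  rw [← LinearMap.ker_eq_bot, LinearMap.ker_eq_bot']
  rintro ⟨α, β, t⟩ h0
  have e : ∀ i j, α i + (Fin.cons 0 β : Fin 9 → ℝ) j +
      lineFn 0 (t 0 + t 1 * κ) (t 0) (t 1 * γ) (t 1 * δ) (idx j - idx i) = 0 :=
    fun i j => congrFun (congrFun h0 i) j
  -- The combination of the entries `(0,j) + (j,0) - (0,0) - (j,j)` kills row and column phases,
  -- while an even pattern vanishing at `0` is doubled.
  have hmix : ∀ j, lineFn 0 (t 0 + t 1 * κ) (t 0) (t 1 * γ) (t 1 * δ) (idx j - idx 0) +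
      lineFn 0 (t 0 + t 1 * κ) (t 0) (t 1 * γ) (t 1 * δ) (idx 0 - idx j) = 0 := by
    intro j
    have e1 := e 0 j
    have e2 := e j 0
    have e3 := e 0 0
    have e4 := e j j
    have hz : ∀ a b c d : ℝ, lineFn 0 a b c d (0 : G) = 0 := fun _ _ _ _ => rfl
    rw [sub_self, hz] at e3 e4
    linarith
  -- The indices 3, 4, 5 are `(1,0), (1,1), (1,2)`, where the pattern takes its second, third and
  -- fourth values.
  have hb : t 0 + t 0 = 0 := hmix 3
  have hc : t 1 * γ + t 1 * γ = 0 := hmix 4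
  have hd : t 1 * δ + t 1 * δ = 0 := hmix 5
  have t0 : t 0 = 0 := by linarith
  have t1 : t 1 = 0 := by
    rcases h with h | h
    · have : t 1 * γ = 0 := by linarith
      simpa [h] using this
    · have : t 1 * δ = 0 := by linarith
      simpa [h] using this
  have hz : ∀ s, lineFn (0 : ℝ) 0 0 0 0 s = 0 := fun s => by simp [lineFn]
  simp only [t0, t1, zero_mul, add_zero, hz] at e
  have hα : ∀ i, α i = 0 := fun i => by simpa using e i 0
  simp only [hα, zero_add] at e
  have hβ : ∀ j, β j = 0 := fun j => by simpa using e 0 j.succ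
  refine Prod.ext (funext hα) (Prod.ext (funext hβ) (funext fun i => ?_))
  fin_cases i
  · exact t0
  · exact t1

theorem le_finrank_ker {m : ℂ} (hm : ‖m‖ = 1) :
    19 ≤ Module.finrank ℝ (LinearMap.ker (unitarityDeriv (matA m))) := by
  obtain ⟨κ, γ, δ, hne, hp⟩ := exists_tangent hm
  have hmem : ∀ v, tangentMap κ γ δ v ∈ LinearMap.ker (unitarityDeriv (matA m)) := by
    intro v
    rw [LinearMap.mem_ker]
    change unitarityDeriv (matA m) (_ + _) = 0
    rw [map_add, add_mem_ker (isHadamard_matA hm), matA, pattern_mem_ker (matA_sum m), add_zero]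
    push_cast
    linear_combination (v.2.2 1 : ℂ) * hp
  have hinj : Function.Injective
      ((tangentMap κ γ δ).codRestrict (LinearMap.ker (unitarityDeriv (matA m))) hmem) :=
    fun v v' hv => tangentMap_injective hne (congrArg Subtype.val hv)
  refine le_trans ?_ (LinearMap.finrank_le_finrank_of_injective hinj)
  simp [Module.finrank_prod]

/-! ### The defect along the family -/

theorem two_le_defect {m : ℂ} (hm : ‖m‖ = 1) : 2 ≤ defect (matA m) := by
  have := le_finrank_ker hm
  rw [defect]
  push_cast
  omega

theorem defect_eq_two {m : ℂ} (hm : ‖m‖ = 1) (h12 : m ^ 12 ≠ 1) : defect (matA m) = 2 := by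
  have := le_finrank_ker hm
  have := finrank_ker_le hm h12
  rw [defect]
  push_cast
  omega

theorem exists_norm_eq_one_pow_twelve_ne_one : ∃ m : ℂ, ‖m‖ = 1 ∧ m ^ 12 ≠ 1 := by
  refine ⟨3 / 5 + 4 / 5 * Complex.I, ?_, fun h => ?_⟩
  · rw [← sq_eq_sq₀ (norm_nonneg _) zero_le_one, ← Complex.normSq_eq_norm_sq, Complex.normSq_apply]
    norm_num
  · have h2 : (3 / 5 + 4 / 5 * Complex.I) ^ 2 = -7 / 25 + 24 / 25 * Complex.I := by
      linear_combination 16 / 25 * Complex.I_sq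
    have h4 : (3 / 5 + 4 / 5 * Complex.I) ^ 4 = -527 / 625 - 336 / 625 * Complex.I := by
      rw [show (3 / 5 + 4 / 5 * Complex.I) ^ 4 = ((3 / 5 + 4 / 5 * Complex.I) ^ 2) ^ 2 by ring, h2]
      linear_combination 576 / 625 * Complex.I_sq
    rw [show (3 / 5 + 4 / 5 * Complex.I) ^ 12 = ((3 / 5 + 4 / 5 * Complex.I) ^ 4) ^ 3 by ring,
      h4] at h
    have := congrArg Complex.im h
    norm_num [pow_succ] at this

theorem isGenericDefect_BC9A : IsGenericDefect BC9A 2 := by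
  obtain ⟨m, hm, h12⟩ := exists_norm_eq_one_pow_twelve_ne_one
  refine ⟨⟨matA m, ⟨m, hm, rfl⟩, defect_eq_two hm h12⟩, ?_⟩
  rintro _ ⟨_, ⟨μ, hμ, rfl⟩, rfl⟩
  exact two_le_defect hμ

theorem finite_defect_ne_two : {μ : ℂ | ‖μ‖ = 1 ∧ defect (matA μ) ≠ 2}.Finite := by
  refine (Polynomial.nthRootsFinset 12 (1 : ℂ)).finite_toSet.subset ?_
  rintro μ ⟨hμ, hd⟩
  rw [Finset.mem_coe, Polynomial.mem_nthRootsFinset (by norm_num)]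
  by_contra h12
  exact hd (defect_eq_two hμ h12)

/-! ### Parameter permutations, values of `ζ` and limits -/

theorem BC9A_subset : BC9A ⊆ BC9Two := by
  rintro _ ⟨m, hm, rfl⟩
  exact ⟨m, -m, -om, -om ^ 2, hm, by rwa [norm_neg], by rw [norm_neg, norm_om], norm_om_sq,
    matA_sum m, rfl⟩

theorem perm_mem_BC9Two {μ x y u w : ℂ} (hμ : ‖μ‖ = 1)
    (h : [x, y, u, w].Perm [μ, -μ, -om, -om ^ 2]) : basicForm x y u w ∈ BC9Two := by
  have hn : ∀ z ∈ [x, y, u, w], ‖z‖ = 1 := by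
    intro z hz
    have hz := h.mem_iff.1 hz
    simp only [List.mem_cons, List.not_mem_nil, or_false] at hz
    rcases hz with rfl | rfl | rfl | rfl
    · exact hμ
    · rwa [norm_neg]
    · rw [norm_neg, norm_om]
    · exact norm_om_sq
  have hs := h.sum_eq
  simp only [List.sum_cons, List.sum_nil, add_zero] at hs
  refine ⟨x, y, u, w, hn x (by simp), hn y (by simp), hn u (by simp), hn w (by simp), ?_, rfl⟩
  linear_combination hs + matA_sum μ

theorem sum_first_two_of_perm {α : Type*} [AddCommMonoid α] {x y u w a b c d : α}
    (h : [x, y, u, w].Perm [a, b, c, d]) :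
    x + y = a + b ∨ x + y = a + c ∨ x + y = a + d ∨ x + y = b + c ∨ x + y = b + d ∨
      x + y = c + d := by
  rw [← List.mem_permutations'] at h
  simp only [List.permutations', List.permutations'Aux, List.flatMap_cons, List.flatMap_nil,
    List.map_cons, List.map_nil, List.append_nil, List.cons_append, List.nil_append,
    List.mem_cons, List.not_mem_nil, or_false, List.cons.injEq, and_true] at h
  rcases h with h | h | h | h | h | h | h | h | h | h | h | h | h | h | h | h | h | h | h | h |
    h | h | h | h <;> obtain ⟨rfl, rfl, -, -⟩ := h <;> simp [add_comm]

theorem zeta_values {μ x y u w : ℂ} (h : [x, y, u, w].Perm [μ, -μ, -om, -om ^ 2]) :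
    2 * (x + y) - 1 = 1 ∨ 2 * (x + y) - 1 = -1 ∨
      2 * (x + y) - 1 = Complex.I * (Real.sqrt 3 : ℂ) + 2 * μ ∨
      2 * (x + y) - 1 = Complex.I * (Real.sqrt 3 : ℂ) - 2 * μ ∨
      2 * (x + y) - 1 = -(Complex.I * (Real.sqrt 3 : ℂ)) + 2 * μ ∨
      2 * (x + y) - 1 = -(Complex.I * (Real.sqrt 3 : ℂ)) - 2 * μ := by
  have hq := om_quadratic
  have ho := om_eq
  rcases sum_first_two_of_perm h with h | h | h | h | h | h <;> rw [h]
  · exact Or.inr (Or.inl (by ring))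
  · exact Or.inr (Or.inr (Or.inr (Or.inr (Or.inl (by linear_combination -2 * ho)))))
  · exact Or.inr (Or.inr (Or.inl (by linear_combination -2 * hq + 2 * ho)))
  · exact Or.inr (Or.inr (Or.inr (Or.inr (Or.inr (by linear_combination -2 * ho)))))
  · exact Or.inr (Or.inr (Or.inr (Or.inl (by linear_combination -2 * hq + 2 * ho))))
  · exact Or.inl (by linear_combination -2 * hq)

/-- Here `|1 + ζ| = ε`; absorbing this factor into the square root removes the singularity and
leaves an expression continuous at `ε = 0`. -/
theorem zetaEntry_small {μ : ℂ} (hμ : ‖μ‖ = 1) (s : ℝ) {ε : ℝ} (hε : 0 < ε) :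
    zetaEntry s (1 + (-1 - ε * Complex.I * μ)) =
      -(1 / 4 : ℂ) * Complex.I * μ * (ε + s * Complex.I * (Real.sqrt (16 - ε ^ 2) : ℂ)) := by
  have hn : ‖1 + (-1 - (ε : ℂ) * Complex.I * μ)‖ = ε := by
    rw [add_sub, add_neg_cancel, zero_sub, norm_neg, norm_mul, norm_mul, hμ, Complex.norm_I,
      Complex.norm_real, Real.norm_of_nonneg hε.le]
    ring
  have hs : ε * Real.sqrt (16 / ε ^ 2 - 1) = Real.sqrt (16 - ε ^ 2) := by
    rw [show 16 - ε ^ 2 = ε ^ 2 * (16 / ε ^ 2 - 1) by field_simp, Real.sqrt_mul (sq_nonneg _),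
      Real.sqrt_sq hε.le]
  rw [zetaEntry, hn, ← hs]
  push_cast
  ring

theorem tendsto_zetaEntry_small {μ : ℂ} (hμ : ‖μ‖ = 1) (s : ℝ) :
    Tendsto (fun ε : ℝ => zetaEntry s (1 + (-1 - ε * Complex.I * μ))) (𝓝[>] 0) (𝓝 (s * μ)) := by
  have hcont : Continuous fun ε : ℝ =>
      -(1 / 4 : ℂ) * Complex.I * μ * (ε + s * Complex.I * (Real.sqrt (16 - ε ^ 2) : ℂ)) := by
    fun_prop
  have h0 := (hcont.tendsto 0).mono_left (nhdsWithin_le_nhds (s := Set.Ioi 0))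
  have hv : -(1 / 4 : ℂ) * Complex.I * μ *
      ((0 : ℝ) + s * Complex.I * (Real.sqrt (16 - (0 : ℝ) ^ 2) : ℂ)) = s * μ := by
    rw [show (16 : ℝ) - 0 ^ 2 = 4 ^ 2 by norm_num, Real.sqrt_sq (by norm_num)]
    push_cast
    linear_combination -μ * s * Complex.I_sq
  rw [hv] at h0
  refine h0.congr' ?_
  filter_upwards [self_mem_nhdsWithin] with ε hε
  exact (zetaEntry_small hμ s hε).symm

theorem tendsto_zetaEntry_large (μ : ℂ) (s : ℝ) :
    Tendsto (fun ε : ℝ => zetaEntry s (1 - (-1 - ε * Complex.I * μ))) (𝓝[>] 0)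
      (𝓝 (1 / 2 + s * Complex.I * (Real.sqrt 3 : ℂ) / 2)) := by
  have hcont : ContinuousAt
      (fun ε : ℝ => zetaEntry s (1 - (-1 - ε * Complex.I * μ))) 0 := by
    have hne : ‖(1 : ℂ) - (-1 - ((0 : ℝ) : ℂ) * Complex.I * μ)‖ ^ 2 ≠ 0 := by norm_num
    unfold zetaEntry
    fun_prop (disch := exact hne)
  have hv : zetaEntry s (1 - (-1 - ((0 : ℝ) : ℂ) * Complex.I * μ)) =
      1 / 2 + s * Complex.I * (Real.sqrt 3 : ℂ) / 2 := by
    have : (1 : ℂ) - (-1 - ((0 : ℝ) : ℂ) * Complex.I * μ) = 2 := by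
      push_cast
      ring
    rw [this, zetaEntry, Complex.norm_ofNat, show (16 : ℝ) / 2 ^ 2 - 1 = 3 by norm_num]
    ring
  rw [← hv]
  exact hcont.tendsto.mono_left nhdsWithin_le_nhds

theorem matA_eq_ofBlocks (μ : ℂ) :
    ∃ A B : Matrix (Fin 3) (Fin 3) ℂ,
      A = !![1, μ, μ; μ, 1, μ; μ, μ, 1] ∧
      B = -!![μ, om, om ^ 2; om ^ 2, μ, om; om, om ^ 2, μ] ∧
      matA μ = ofBlocks !![A, B, B.transpose; B.transpose, A, B; B, B.transpose, A] := by
  refine ⟨_, _, rfl, rfl, ?_⟩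
  ext i j
  fin_cases i <;> fin_cases j <;> rfl

/-! ### The affine parametrisation -/

/-- Phases of the generating function of `matA`: constant part. -/
noncomputable def phase : G → ℝ := lineFn 0 0 Real.pi (-(Real.pi / 3)) (Real.pi / 3)

/-- Phases of the generating function of `matA`: velocity. -/
def velocity : G → ℝ := lineFn 0 1 1 0 0

theorem exp_neg_pi_div_three : Complex.exp (Complex.I * ((-(Real.pi / 3) : ℝ) : ℂ)) = -om := by
  rw [mul_comm, Complex.exp_mul_I, ← Complex.ofReal_cos, ← Complex.ofReal_sin, Real.cos_neg,
    Real.sin_neg, Real.cos_pi_div_three, Real.sin_pi_div_three, om_eq]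
  push_cast
  ring

theorem exp_pi_div_three : Complex.exp (Complex.I * ((Real.pi / 3 : ℝ) : ℂ)) = -om ^ 2 := by
  rw [mul_comm, Complex.exp_mul_I, ← Complex.ofReal_cos, ← Complex.ofReal_sin,
    Real.cos_pi_div_three, Real.sin_pi_div_three]
  push_cast
  linear_combination om_quadratic - om_eq

theorem genFn_exp (t : ℝ) (s : G) : genFn (Complex.exp (Complex.I * t)) s =
    Complex.exp (Complex.I * ((phase s + t * velocity s : ℝ) : ℂ)) := by
  have h0 : (1 : ℂ) = Complex.exp (Complex.I * ((0 + t * 0 : ℝ) : ℂ)) := by simp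
  have h1 : Complex.exp (Complex.I * t) = Complex.exp (Complex.I * ((0 + t * 1 : ℝ) : ℂ)) := by
    simp
  have h2 : -Complex.exp (Complex.I * t) =
      Complex.exp (Complex.I * ((Real.pi + t * 1 : ℝ) : ℂ)) := by
    rw [mul_one, Complex.ofReal_add, mul_add, Complex.exp_add, mul_comm _ (Real.pi : ℂ),
      Complex.exp_pi_mul_I, neg_one_mul]
  have h3 : -om = Complex.exp (Complex.I * ((-(Real.pi / 3) + t * 0 : ℝ) : ℂ)) := by
    rw [mul_zero, add_zero, exp_neg_pi_div_three]
  have h4 : -om ^ 2 = Complex.exp (Complex.I * ((Real.pi / 3 + t * 0 : ℝ) : ℂ)) := by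
    rw [mul_zero, add_zero, exp_pi_div_three]
  revert s
  rw [forall_G]
  exact ⟨h0, h1, h1, h2, h3, h4, h2, h4, h3⟩

/-- The mixed difference of a real function of the index difference, normalised to vanish in the
first row and column. -/
def mixedDiff (a : G → ℝ) : Matrix (Fin 9) (Fin 9) ℝ :=
  Matrix.of fun i j => -a (idx 0 - idx i) + a 0 + a (idx j - idx i) - a (idx j - idx 0)

theorem dephase_matA_exp (t : ℝ) : dephase (matA (Complex.exp (Complex.I * t))) =
    Matrix.of fun j k => Complex.exp (Complex.I *
      ((mixedDiff phase j k + t * mixedDiff velocity j k : ℝ) : ℂ)) := by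
  ext i j
  simp only [dephase, Matrix.of_apply, matA_apply, genFn_exp, ← Complex.exp_neg,
    ← Complex.exp_add, mixedDiff, sub_self]
  congr 1
  push_cast
  ring

theorem isAffineOrbit_BC9A : IsAffineOrbit 1 BC9A := by
  refine ⟨?_, mixedDiff phase,
    (LinearMap.proj (R := ℝ) (φ := fun _ : Fin 1 => ℝ) 0).smulRight (mixedDiff velocity), ?_, ?_⟩
  · rintro _ ⟨m, hm, rfl⟩
    exact isHadamard_matA hm
  · intro s t hst
    have h1 := congrFun (congrFun hst 1) 1
    -- One entry with nonzero velocity, here `-2`, suffices for injectivity.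
    have h2 : mixedDiff velocity 1 1 = -1 + 0 + 0 - 1 := rfl
    simp only [LinearMap.smulRight_apply, LinearMap.proj_apply, Matrix.smul_apply, h2,
      smul_eq_mul] at h1
    funext i
    rw [Subsingleton.elim i 0]
    linarith
  · ext K
    constructor
    · rintro ⟨_, ⟨m, hm, rfl⟩, rfl⟩
      refine ⟨fun _ => m.arg, ?_⟩
      have hm' : m = Complex.exp (Complex.I * m.arg) := by
        have := Complex.norm_mul_exp_arg_mul_I m
        rw [hm, Complex.ofReal_one, one_mul, mul_comm] at this
        exact this.symm
      conv_rhs => rw [hm', dephase_matA_exp]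
      rfl
    · rintro ⟨t, rfl⟩
      refine ⟨matA (Complex.exp (Complex.I * t 0)), ⟨_, ?_, rfl⟩, ?_⟩
      · rw [mul_comm, Complex.norm_exp_ofReal_mul_I]
      · rw [dephase_matA_exp]
        rfl

/-! ### Inequivalence with the Fourier orbit -/

/-- Exponents of `i` in the cubes of the entries of `matA i`. -/
def cubeExp : G → ZMod 4 := lineFn 0 3 1 2 2

/-- For any two distinct rows, with index difference `d`, some 2×2 minor of the matrix of cubed
entries is nonzero. -/
theorem exists_cubeExp_ne : ∀ d : G, d ≠ 0 →
    ∃ s t, cubeExp s + cubeExp (t + d) ≠ cubeExp (s + d) + cubeExp t := by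
  decide

theorem genFn_I_cube (s : G) :
    genFn Complex.I s ^ 3 = AddChar.zmodChar 4 Complex.I_pow_four (cubeExp s) := by
  have v0 : AddChar.zmodChar 4 Complex.I_pow_four 0 = 1 := AddChar.map_zero_eq_one _
  have v1 : AddChar.zmodChar 4 Complex.I_pow_four 1 = Complex.I ^ 1 := rfl
  have v2 : AddChar.zmodChar 4 Complex.I_pow_four 2 = Complex.I ^ 2 := rfl
  have v3 : AddChar.zmodChar 4 Complex.I_pow_four 3 = Complex.I ^ 3 := rfl
  have h0 : (1 : ℂ) ^ 3 = AddChar.zmodChar 4 Complex.I_pow_four 0 := by rw [v0, one_pow]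
  have h1 : Complex.I ^ 3 = AddChar.zmodChar 4 Complex.I_pow_four 3 := v3.symm
  have h2 : (-Complex.I) ^ 3 = AddChar.zmodChar 4 Complex.I_pow_four 1 := by
    rw [v1]
    linear_combination -Complex.I * Complex.I_sq
  have h3 : (-om) ^ 3 = AddChar.zmodChar 4 Complex.I_pow_four 2 := by
    rw [v2, Complex.I_sq]
    linear_combination -om_cube
  have h4 : (-om ^ 2) ^ 3 = AddChar.zmodChar 4 Complex.I_pow_four 2 := by
    rw [v2, Complex.I_sq]
    linear_combination -(om ^ 3 + 1) * om_cube
  revert s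
  rw [forall_G]
  exact ⟨h0, h1, h1, h2, h3, h4, h2, h4, h3⟩

theorem zmodChar_I_injective :
    Function.Injective (AddChar.zmodChar 4 Complex.I_pow_four) := by
  have h3 : Complex.I ^ 3 = -Complex.I := Complex.I_pow_three
  have h1 : Complex.I ≠ 1 := by simp [Complex.ext_iff]
  have h2 : -Complex.I ≠ 1 := by simp [Complex.ext_iff]
  rw [AddChar.injective_iff]
  intro s hs
  fin_cases s
  · rfl
  · exact absurd ((pow_one Complex.I).symm.trans hs) h1
  · exact absurd (Complex.I_sq.symm.trans hs) (by norm_num)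
  · exact absurd (h3.symm.trans hs) h2

/-- Rows 0 and 3 are the first rows of the first two block rows; they differ only by the cube roots
of unity multiplying the blocks. -/
theorem fourierForm_three_cube (x₁ x₂ x₃ x₄ : ℂ) (j : Fin 9) :
    fourierForm x₁ x₂ x₃ x₄ 3 j ^ 3 = fourierForm x₁ x₂ x₃ x₄ 0 j ^ 3 := by
  have h6 : (om ^ 2) ^ 3 = 1 := by rw [← pow_mul, mul_comm, pow_mul, om_cube, one_pow]
  have h1 : ∀ z : ℂ, (om * z) ^ 3 = z ^ 3 := fun z => by rw [mul_pow, om_cube, one_mul]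
  have h2 : ∀ z : ℂ, (om ^ 2 * z) ^ 3 = z ^ 3 := fun z => by rw [mul_pow, h6, one_mul]
  fin_cases j
  · rfl
  · rfl
  · rfl
  · exact h1 _
  · exact h1 _
  · exact h1 _
  · exact h2 _
  · exact h2 _
  · exact h2 _

theorem equivalent_apply {n : ℕ} {H K : Matrix (Fin n) (Fin n) ℂ} (p q : Equiv.Perm (Fin n))
    (d e : Fin n → ℂ) (h : H = p.permMatrix ℂ * Matrix.diagonal d * K * Matrix.diagonal e *
      q.permMatrix ℂ) (i j : Fin n) :
    H i j = d (p i) * K (p i) (q.symm j) * e (q.symm j) := by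
  rw [h, mul_assoc, mul_assoc, mul_assoc, Equiv.Perm.permMatrix,
    Equiv.Perm.permMatrix, PEquiv.toMatrix_toPEquiv_mul, Matrix.submatrix_apply, id,
    Matrix.diagonal_mul, ← mul_assoc, PEquiv.mul_toMatrix_toPEquiv, Matrix.submatrix_apply, id,
    Matrix.mul_diagonal, mul_assoc]

theorem not_isSuborbit : ¬ IsSuborbit BC9A F9Four := by
  intro h
  obtain ⟨_, ⟨x₁, x₂, x₃, x₄, -, -, -, -, rfl⟩, p, q, d, e, -, -, hH⟩ :=
    h (matA Complex.I) ⟨_, Complex.norm_I, rfl⟩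
  have hent := equivalent_apply p q d e hH
  set a := p.symm 0 with ha
  set b := p.symm 3 with hb
  have hab : idx a - idx b ≠ 0 := by
    rw [sub_ne_zero]
    simp [ha, hb]
  -- Rows `a` and `b` come from rows 0 and 3 of the Fourier matrix. Column factors are common to
  -- both and row factors cancel in the cross products, so the cubed rows are proportional.
  have hrow : ∀ j k, matA Complex.I a j ^ 3 * matA Complex.I b k ^ 3 =
      matA Complex.I b j ^ 3 * matA Complex.I a k ^ 3 := by
    intro j k
    have h0 := fourierForm_three_cube x₁ x₂ x₃ x₄ (q.symm j)
    have h1 := fourierForm_three_cube x₁ x₂ x₃ x₄ (q.symm k)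
    simp only [hent, ha, hb, Equiv.apply_symm_apply, mul_pow, h0, h1]
    ring
  obtain ⟨s, t, hst⟩ := exists_cubeExp_ne _ hab
  apply hst
  have := hrow (idx.symm (s + idx a)) (idx.symm (t + idx a))
  simp only [matA_apply, genFn_I_cube, Equiv.apply_symm_apply, ← AddChar.map_add_eq_mul,
    add_sub_cancel_right, add_sub_assoc] at this
  exact zmodChar_I_injective this

end BC9

theorem mainTheorem7 :
    -- permutations of the parameters: membership in the two-parameter orbit, and the values of `ζ`
    (∀ μ x y u w : ℂ, ‖μ‖ = 1 → [x, y, u, w].Perm [μ, -μ, -BC9.om, -BC9.om ^ 2] →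
      BC9.basicForm x y u w ∈ BC9.BC9Two ∧
      (2 * (x + y) - 1 = 1 ∨ 2 * (x + y) - 1 = -1 ∨
        2 * (x + y) - 1 = Complex.I * (Real.sqrt 3 : ℂ) + 2 * μ ∨
        2 * (x + y) - 1 = Complex.I * (Real.sqrt 3 : ℂ) - 2 * μ ∨
        2 * (x + y) - 1 = -(Complex.I * (Real.sqrt 3 : ℂ)) + 2 * μ ∨
        2 * (x + y) - 1 = -(Complex.I * (Real.sqrt 3 : ℂ)) - 2 * μ)) ∧
    -- the limit `ζ = -1 - ε i μ`, `ε → 0⁺`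
    (∀ μ : ℂ, ‖μ‖ = 1 →
      Filter.Tendsto (fun ε : ℝ => BC9.zetaEntry 1 (1 + (-1 - ε * Complex.I * μ)))
        (nhdsWithin 0 (Set.Ioi 0)) (nhds μ) ∧
      Filter.Tendsto (fun ε : ℝ => BC9.zetaEntry (-1) (1 + (-1 - ε * Complex.I * μ)))
        (nhdsWithin 0 (Set.Ioi 0)) (nhds (-μ)) ∧
      Filter.Tendsto (fun ε : ℝ => BC9.zetaEntry 1 (1 - (-1 - ε * Complex.I * μ)))
        (nhdsWithin 0 (Set.Ioi 0)) (nhds (-BC9.om ^ 2)) ∧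
      Filter.Tendsto (fun ε : ℝ => BC9.zetaEntry (-1) (1 - (-1 - ε * Complex.I * μ)))
        (nhdsWithin 0 (Set.Ioi 0)) (nhds (-BC9.om))) ∧
    -- the block form of the matrices of the suborbit
    (∀ μ : ℂ, ‖μ‖ = 1 →
      ∃ A B : Matrix (Fin 3) (Fin 3) ℂ,
        A = !![1, μ, μ; μ, 1, μ; μ, μ, 1] ∧
        B = -!![μ, BC9.om, BC9.om ^ 2; BC9.om ^ 2, μ, BC9.om; BC9.om, BC9.om ^ 2, μ] ∧
        BC9.matA μ = BC9.ofBlocks !![A, B, B.transpose; B.transpose, A, B; B, B.transpose, A]) ∧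
    -- an affine one-parameter suborbit of the two-parameter orbit
    BC9.BC9A ⊆ BC9.BC9Two ∧
    BC9.IsAffineOrbit 1 BC9.BC9A ∧
    -- the generic defect is two
    BC9.IsGenericDefect BC9.BC9A 2 ∧
    {μ : ℂ | ‖μ‖ = 1 ∧ BC9.defect (BC9.matA μ) ≠ 2}.Finite ∧
    -- not a suborbit of the Fourier orbit
    ¬ BC9.IsSuborbit BC9.BC9A BC9.F9Four := by
  refine ⟨fun μ x y u w hμ h => ⟨BC9.perm_mem_BC9Two hμ h, BC9.zeta_values h⟩,
    fun μ hμ => ⟨?_, ?_, ?_, ?_⟩, fun μ _ => BC9.matA_eq_ofBlocks μ, BC9.BC9A_subset,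
    BC9.isAffineOrbit_BC9A, BC9.isGenericDefect_BC9A, BC9.finite_defect_ne_two,
    BC9.not_isSuborbit⟩
  · simpa using BC9.tendsto_zetaEntry_small hμ 1
  · simpa using BC9.tendsto_zetaEntry_small hμ (-1)
  · convert BC9.tendsto_zetaEntry_large μ 1 using 2
    push_cast
    linear_combination BC9.om_eq - BC9.om_quadratic
  · convert BC9.tendsto_zetaEntry_large μ (-1) using 2
    push_cast
    linear_combination -BC9.om_eq
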